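/- **Setting.** Fix real numbers $0<\delta\le M$ (resolution and magnitude bound). A *looped neural network* consists of a state dimension $n\ge 3$ and a feedforward block $f_\theta:\mathbb R^n\to\mathbb R^n$, $f_\theta=A_L\circ\mathrm{ReLU}\circ A_{L-1}\circ\cdots\circ\mathrm{ReLU}\circ A_1$, with any number $L\ge1$ of affine layers $A_i(x)=W_ix+b_i$ of any hidden widths, and ReLU applied coordinatewise; $\theta$ is the vector of all entries of the $W_i$ and $b_i$, and $\|\theta\|_0$ is the number of its non-zero entries. The network has precision $(\delta,M)$, written $\theta\in\Theta_{\delta,M}$, if all entries of $\theta$ lie in $\delta\mathbb Z\cap[-M,M]$. It is run by $x_0=0$, $x_{t+1}=f_\theta(x_t)$, in exact real arithmetic. At each iteration $t\ge1$: if the first coordinate of $x_t$ is $>0$, the network halts; otherwise, if the second coordinate of $x_t$ is $>0$, the bit $\mathbf 1[(x_t)_3>0]$ is appended to the output. The network *outputs* $s\in\{0,1\}^*$ if it halts and the bits accumulated until then form $s$. The *neural complexity* of $s\in\{0,1\}^*$ is $$\mathcal N(s)=\inf\{\|\theta\|_0:\theta\in\Theta_{\delta,M},\ \theta\text{ outputs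 }s\}\in\mathbb N\cup\{\infty\},\qquad \inf\emptyset=\infty .$$ A function $F:\{0,1\}^*\to\mathbb N\cup\{\infty\}$ is *computable* if an algorithm computes $F(s)$ from $s$. It is *upper-semicomputable* if there is a computable $\varphi:\{0,1\}^*\times\mathbb N\to\mathbb N\cup\{\infty\}$ such that, for every $s$, $\varphi(s,k)$ is non-increasing in $k$ and $\lim_{k\to\infty}\varphi(s,k)=F(s)$. A real number $x$ is *computable* if some algorithm finds, for every $n$, an integer $a_n$ with $|x-a_n2^{-n}|\le2^{-n}$. **Proposition.** The neural complexity $\mathcal N$ is upper-semicomputable but not computable. More precisely, for all real $0<\delta\le M$: (i) if the resolution $\delta$ is a computable real number (for example, rational), then $\mathcal N$ is upper-semicomputable; (ii) $\mathcal N$ is not computable. -/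

import Mathlib

/-- An affine layer `ℝ^m → ℝ^n`, `x ↦ W x + b`; its parameters are the entries of `W` and `b`. -/
structure AffineLayer (m n : ℕ) where
  weight : Matrix (Fin n) (Fin m) ℝ
  bias : Fin n → ℝ

namespace AffineLayer

noncomputable def eval {m n : ℕ} (A : AffineLayer m n) (x : Fin m → ℝ) : Fin n → ℝ :=
  A.weight.mulVec x + A.bias

/-- The number of non-zero parameters of the layer. -/
noncomputable def numNonzero {m n : ℕ} (A : AffineLayer m n) : ℕ :=
  (Finset.univ.filter fun ij : Fin n × Fin m => A.weight ij.1 ij.2 ≠ 0).card +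
    (Finset.univ.filter fun i : Fin n => A.bias i ≠ 0).card

end AffineLayer

/-- The set `δ·ℤ ∩ [-M, M]` of representable parameter values. -/
def fixedPrecisionValues (δ M : ℝ) : Set ℝ :=
  {w | (∃ k : ℤ, w = δ * k) ∧ w ∈ Set.Icc (-M) M}

/-- All parameters of the layer lie in `δ·ℤ ∩ [-M, M]`. -/
def AffineLayer.IsFixedPrecision {m n : ℕ} (δ M : ℝ) (A : AffineLayer m n) : Prop :=
  (∀ i j, A.weight i j ∈ fixedPrecisionValues δ M) ∧ ∀ i, A.bias i ∈ fixedPrecisionValues δ M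

/-- Feedforward networks `ℝ^m → ℝ^n` with any number `L ≥ 1` of affine layers, any hidden widths,
and the ReLU activation between consecutive layers (and not after the last one). -/
inductive FeedforwardNet : ℕ → ℕ → Type
  | last {m n : ℕ} (A : AffineLayer m n) : FeedforwardNet m n
  | cons {m k n : ℕ} (A : AffineLayer m k) (f : FeedforwardNet k n) : FeedforwardNet m n

namespace FeedforwardNet

/-- The function computed by the network: `A_L ∘ ReLU ∘ A_{L-1} ∘ ⋯ ∘ ReLU ∘ A_1`. -/
noncomputable def eval : {m n : ℕ} → FeedforwardNet m n → (Fin m → ℝ) → (Fin n → ℝ)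
  | _, _, last A, x => A.eval x
  | _, _, cons A f, x => f.eval fun i => max (A.eval x i) 0

/-- The non-zero parameter count `‖θ‖₀` of the network. -/
noncomputable def numNonzero : {m n : ℕ} → FeedforwardNet m n → ℕ
  | _, _, last A => A.numNonzero
  | _, _, cons A f => A.numNonzero + f.numNonzero

/-- `θ ∈ Θ_{δ,M}`: every parameter of the network lies in `δ·ℤ ∩ [-M, M]`. -/
def IsFixedPrecision (δ M : ℝ) : {m n : ℕ} → FeedforwardNet m n → Prop
  | _, _, last A => A.IsFixedPrecision δ M
  | _, _, cons A f => A.IsFixedPrecision δ M ∧ f.IsFixedPrecision δ M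

end FeedforwardNet

/-- A looped neural network: a feedforward block on the state space `ℝ^n`. The state has (at least)
the three designated coordinates `halt`, `emit` and `bit`. -/
structure LoopedNet where
  n : ℕ
  three_le : 3 ≤ n
  block : FeedforwardNet n n

namespace LoopedNet

/-- The state `x_t`: `x_0 = 0` and `x_{t+1} = f_θ(x_t)`. -/
noncomputable def state (N : LoopedNet) (t : ℕ) : Fin N.n → ℝ :=
  N.block.eval^[t] 0

/-- The value of the halt channel (coordinate 1) at iteration `t`. -/
noncomputable def halt (N : LoopedNet) (t : ℕ) : ℝ := N.state t ⟨0, by have := N.three_le; omega⟩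

/-- The value of the emit channel (coordinate 2) at iteration `t`. -/
noncomputable def emit (N : LoopedNet) (t : ℕ) : ℝ := N.state t ⟨1, by have := N.three_le; omega⟩

/-- The value of the bit channel (coordinate 3) at iteration `t`. -/
noncomputable def bit (N : LoopedNet) (t : ℕ) : ℝ := N.state t ⟨2, by have := N.three_le; omega⟩

/-- The bits appended to the output during the iterations `1, …, t`, if the network does not halt
at any of them. -/
noncomputable def emitted (N : LoopedNet) : ℕ → List Bool
  | 0 => []
  | t + 1 => if 0 < N.emit (t + 1) then N.emitted t ++ [decide (0 < N.bit (t + 1))] else N.emitted t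

/-- The network outputs `s`: its first halting iteration is `τ + 1`, and the bits accumulated
during the iterations `1, …, τ` form the string `s`. -/
def Outputs (N : LoopedNet) (s : List Bool) : Prop :=
  ∃ τ : ℕ, 0 < N.halt (τ + 1) ∧ (∀ t, 1 ≤ t → t ≤ τ → ¬ 0 < N.halt t) ∧ N.emitted τ = s

end LoopedNet

/-- The neural complexity `𝒩(s)` in precision `(δ, M)`: the infimum (in `ℕ ∪ {∞}`, so `∞` over the
empty set) of `‖θ‖₀` over the looped networks `θ ∈ Θ_{δ,M}` that output `s`. -/
noncomputable def neuralComplexity (δ M : ℝ) (s : List Bool) : ℕ∞ :=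
  sInf {c | ∃ N : LoopedNet, N.block.IsFixedPrecision δ M ∧ N.Outputs s ∧
    c = (N.block.numNonzero : ℕ∞)}

/-- The element of `ℕ ∪ {∞}` named by an `Option ℕ`, with `none` standing for `∞`. -/
def extNat : Option ℕ → ℕ∞
  | none => ⊤
  | some n => (n : ℕ∞)

/-- `F : {0,1}* → ℕ ∪ {∞}` is computable. -/
def IsComputableENat (F : List Bool → ℕ∞) : Prop :=
  ∃ φ : List Bool → Option ℕ, Computable φ ∧ ∀ s, extNat (φ s) = F s

/-- `F : {0,1}* → ℕ ∪ {∞}` is upper-semicomputable: it is the pointwise limit of a computable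
sequence of approximations from above, `φ(s,0) ≥ φ(s,1) ≥ ⋯ → F(s)`. -/
def IsUpperSemicomputable (F : List Bool → ℕ∞) : Prop :=
  ∃ φ : List Bool → ℕ → Option ℕ, Computable₂ φ ∧
    ∀ s, Antitone (fun k => extNat (φ s k)) ∧
      Filter.Tendsto (fun k => extNat (φ s k)) Filter.atTop (nhds (F s))

/-- `x` is a computable real number: some algorithm finds, for every `n`, a dyadic rational
`a / 2^n` within distance `2^{-n}` of `x`. -/
def IsComputableReal (x : ℝ) : Prop :=
  ∃ a : ℕ → ℤ, Computable a ∧ ∀ n : ℕ, |x - (a n : ℝ) / 2 ^ n| ≤ 1 / 2 ^ n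

/-! Non-computability is Berry's paradox. The complexity is unbounded: a block with at least as many
hidden layers as non-zero parameters has a layer that vanishes identically, so it is constant and
its network can output only the empty string (`LoopedNet.depth_lt_of_outputs`); any other network
with at most `m` non-zero parameters can be rewritten, without changing its output, with constant
width `m + 3` (`LoopedNet.exists_ofFn`). Over a finite set of parameter values this leaves finitely
many networks, hence finitely many outputs. If the complexity were computable, so would be the map
sending `p` to the first string `S p` of complexity above `p ^ 3`. A register machine prints `S p`
with `p + c` instructions and a fixed number of registers: `p` increments, then a fixed program
(`RegInstr.exists_steps_of_computable`). A looped network simulates it with a number of neurons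
linear in `p`, so with `O(p ^ 2)` parameters (`RegInstr.exists_net_outputs`), a contradiction for
large `p`.

The simulation must use weights in `{-δ, 0, δ}` only, since `M = δ` is allowed. Each hidden neuron
is therefore repeated `k` times with `k * δ ^ 2 ≥ 1`. The state represents a configuration up to a
scale that never drops below `1`; ReLU is positively homogeneous and the output reads only signs, so
the scale is harmless.

For upper semicomputability, the complexity is an infimum over codes of a constant-width network
with a running time. Each code is checked exactly: the parameters are integer multiples of `δ`, so
all neuron values are integer polynomials in `δ`, and ReLU needs only their signs. These are
decidable (`exists_computable_pos`): strict inequalities are found by approximation, and vanishing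
at `δ` is found by searching for a multiple of one fixed polynomial that generates the relations of
`δ` up to constants. This polynomial and `⌊M / δ⌋₊` are constants of the algorithm; they need not be
obtained effectively. -/

/-! ### Partial recursive functions on structured register programs -/

/-- Structured programs over registers indexed by `ℕ`, with an instruction that outputs a bit. -/
inductive RegProg
  | skip
  | inc (r : ℕ)
  | dec (r : ℕ)
  | emit (b : Bool)
  | seq (p q : RegProg)
  | loop (r : ℕ) (p : RegProg)

namespace RegProg

open Function (update)

/-- `Run p σ o σ'`: started in the register contents `σ`, the program `p` terminates with the
contents `σ'` and outputs the bits `o`. -/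
inductive Run : RegProg → (ℕ → ℕ) → List Bool → (ℕ → ℕ) → Prop
  | skip (σ) : Run skip σ [] σ
  | inc (r σ) : Run (inc r) σ [] (update σ r (σ r + 1))
  | dec (r σ) : Run (dec r) σ [] (update σ r (σ r - 1))
  | emit (b σ) : Run (emit b) σ [b] σ
  | seq {p q σ σ₁ σ₂ o₁ o₂} : Run p σ o₁ σ₁ → Run q σ₁ o₂ σ₂ → Run (seq p q) σ (o₁ ++ o₂) σ₂
  | loop_done {r p σ} : σ r = 0 → Run (loop r p) σ [] σ
  | loop_step {r p σ σ₁ σ₂ o₁ o₂} : σ r ≠ 0 → Run p σ o₁ σ₁ → Run (loop r p) σ₁ o₂ σ₂ →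
      Run (loop r p) σ (o₁ ++ o₂) σ₂

theorem Run.congr {p σ o σ₁ σ₂} (h : Run p σ o σ₁) (e : σ₁ = σ₂) : Run p σ o σ₂ := e ▸ h

theorem Run.silent_seq {p q σ σ₁ σ₂} (h₁ : Run p σ [] σ₁) (h₂ : Run q σ₁ [] σ₂) :
    Run (.seq p q) σ [] σ₂ := h₁.seq h₂

/-- The loop invariant is the family `st`, indexed by the remaining value of the counter; a counting
loop then needs only the analysis of one pass through its body. -/
theorem Run.countdown {r p} (st : ℕ → ℕ → ℕ) (hr : ∀ k, st k r = k) :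
    ∀ n, (∀ k < n, Run p (st (k + 1)) [] (st k)) → Run (loop r p) (st n) [] (st 0)
  | 0, _ => .loop_done (hr 0)
  | n + 1, h => .loop_step (o₁ := []) (o₂ := []) (by simp [hr]) (h n (by omega))
      (countdown st hr n fun k hk => h k (by omega))

/-- Set a register to `0`. -/
def clear (r : ℕ) : RegProg := loop r (dec r)

theorem run_clear (r σ) : Run (clear r) σ [] (update σ r 0) := by
  have := Run.countdown (r := r) (p := dec r) (fun k => update σ r k) (by simp) (σ r) fun k _ =>
    (Run.dec r _).congr (by simp)
  simpa [clear] using this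

/-- Add the first register to the second one and set the first one to `0`. -/
def move (a b : ℕ) : RegProg := loop a (seq (dec a) (inc b))

theorem run_move {a b} (σ) (h : a ≠ b) :
    Run (move a b) σ [] (update (update σ a 0) b (σ b + σ a)) := by
  have := Run.countdown (r := a) (p := seq (dec a) (inc b))
    (fun k => update (update σ a k) b (σ b + (σ a - k))) (by simp [h]) (σ a) fun k hk =>
      ((Run.dec a _).silent_seq (.inc b _)).congr (by
        ext x
        simp only [Function.update_apply]
        split_ifs <;> first | rfl | omega)
  simpa [move] using this

/-- Copy a register to one that holds `0`, using another one that holds `0`. -/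
def copy (a b c : ℕ) : RegProg :=
  seq (loop a (seq (dec a) (seq (inc b) (inc c)))) (move c a)

theorem run_copy {a b c} (σ) (hab : a ≠ b) (hac : a ≠ c) (hbc : b ≠ c) (hb : σ b = 0)
    (hc : σ c = 0) : Run (copy a b c) σ [] (update σ b (σ a)) := by
  have := Run.countdown (r := a) (p := seq (dec a) (seq (inc b) (inc c)))
    (fun k => update (update (update σ a k) b (σ a - k)) c (σ a - k)) (by simp [hab, hac]) (σ a)
      fun k hk =>
      ((Run.dec a _).silent_seq ((Run.inc b _).silent_seq (.inc c _))).congr (by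
        ext x
        simp only [Function.update_apply]
        split_ifs <;> simp_all <;> omega)
  have h2 : update (update (update σ a (σ a)) b (σ a - σ a)) c (σ a - σ a) = σ := by
    ext x
    simp only [Function.update_apply]
    split_ifs <;> simp_all
  beta_reduce at this
  rw [h2] at this
  refine (this.silent_seq (run_move _ hac.symm)).congr ?_
  ext x
  simp only [Function.update_apply]
  split_ifs <;> simp_all

theorem exists_clearRange (b : ℕ) :
    ∀ n, ∃ P, ∀ σ, Run P σ [] fun r => if b ≤ r ∧ r < b + n then 0 else σ r
  | 0 => ⟨skip, fun σ => (Run.skip σ).congr (by ext x; rw [if_neg (by omega)])⟩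
  | n + 1 => by
    obtain ⟨P, hP⟩ := exists_clearRange b n
    refine ⟨seq P (clear (b + n)), fun σ => ((hP σ).silent_seq (run_clear _ _)).congr ?_⟩
    ext x
    simp only [Function.update_apply]
    split_ifs <;> first | rfl | omega

/-- `f` can be computed by programs that read the arguments from any given registers below `b`,
write the value to the register `b`, and use the registers above `b` as scratch space. -/
def Computes {n : ℕ} (f : List.Vector ℕ n →. ℕ) : Prop :=
  ∀ (ins : Fin n → ℕ) (b : ℕ), (∀ i, ins i < b) → ∃ P : RegProg, ∀ σ : ℕ → ℕ, (∀ r ≥ b, σ r = 0) →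
    ∀ y ∈ f (List.Vector.ofFn fun i => σ (ins i)), Run P σ [] (update σ b y)

theorem computes_zero : Computes (n := 0) fun _ => Part.some 0 := by
  intro ins b _
  refine ⟨skip, fun σ hσ y hy => (Run.skip σ).congr ?_⟩
  obtain rfl : y = 0 := by simpa using hy
  rw [← hσ b le_rfl, Function.update_eq_self]

theorem computes_get {n} (i : Fin n) :
    Computes fun v : List.Vector ℕ n => Part.some (v.get i) := by
  intro ins b hb
  refine ⟨copy (ins i) b (b + 1), fun σ hσ y hy => ?_⟩
  have := hb i
  obtain rfl : y = σ (ins i) := by simpa using hy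
  exact run_copy σ (by omega) (by omega) (by omega) (hσ _ le_rfl) (hσ _ (by omega))

theorem computes_succ :
    Computes fun v : List.Vector ℕ 1 => Part.some (Nat.succ v.head) := by
  intro ins b hb
  obtain ⟨P, hP⟩ := computes_get (0 : Fin 1) ins b hb
  refine ⟨seq P (inc b), fun σ hσ y hy => ?_⟩
  obtain rfl : y = σ (ins 0) + 1 := by simpa using hy
  refine ((hP σ hσ (σ (ins 0)) (by simp)).silent_seq (.inc _ _)).congr (by simp)

theorem mem_of_mem_mOfFn {α : Type*} : ∀ {n : ℕ} {g : Fin n → Part α} {v : List.Vector α n},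
    v ∈ List.Vector.mOfFn g → ∀ i, v.get i ∈ g i
  | 0, _, _, _, i => i.elim0
  | n + 1, g, v, hv, i => by
    simp only [List.Vector.mOfFn, Part.bind_eq_bind, Part.pure_eq_some, Part.mem_bind_iff,
      Part.mem_some_iff] at hv
    obtain ⟨a, ha, w, hw, rfl⟩ := hv
    refine Fin.cases (by simpa using ha) (fun i => ?_) i
    simpa using mem_of_mem_mOfFn hw i

/-- The value number `k` is computed with base register `b + k`, above the values already stored, so
that these survive and its scratch space is still zero. The total function `ys` avoids dependent
indices. -/
theorem exists_evalAll {m n : ℕ} (g : Fin n → List.Vector ℕ m →. ℕ) (hg : ∀ i, Computes (g i))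
    (ins : Fin m → ℕ) (b : ℕ) (hb : ∀ i, ins i < b) :
    ∀ k ≤ n, ∃ P, ∀ σ : ℕ → ℕ, (∀ r ≥ b, σ r = 0) → ∀ ys : ℕ → ℕ,
      (∀ i : Fin n, ys i ∈ g i (List.Vector.ofFn fun i => σ (ins i))) →
      Run P σ [] fun r => if b ≤ r ∧ r < b + k then ys (r - b) else σ r
  | 0, _ => ⟨skip, fun σ _ _ _ => (Run.skip σ).congr (by ext x; rw [if_neg (by omega)])⟩
  | k + 1, hk => by
    obtain ⟨P, hP⟩ := exists_evalAll g hg ins b hb k (by omega)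
    obtain ⟨Q, hQ⟩ := hg ⟨k, by omega⟩ ins (b + k) fun i => (hb i).trans_le (by omega)
    refine ⟨seq P Q, fun σ hσ ys hys => ?_⟩
    refine ((hP σ hσ ys hys).silent_seq (hQ _ ?_ (ys k) ?_)).congr ?_
    · intro r hr
      rw [if_neg (by omega)]
      exact hσ r (by omega)
    · convert hys ⟨k, by omega⟩ using 4 with i
      have := hb i
      rw [if_neg (by omega)]
    · ext x
      simp only [Function.update_apply]
      split_ifs <;> first | rfl | omega | (subst_vars; congr 1; omega)

theorem Computes.comp {m n : ℕ} {f : List.Vector ℕ n →. ℕ} (g : Fin n → List.Vector ℕ m →. ℕ)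
    (hf : Computes f) (hg : ∀ i, Computes (g i)) :
    Computes fun v => (List.Vector.mOfFn fun i => g i v) >>= f := by
  intro ins b hb
  obtain ⟨P, hP⟩ := exists_evalAll g hg ins b hb n le_rfl
  obtain ⟨Q, hQ⟩ := hf (fun i => b + i) (b + n) (by simp)
  obtain ⟨R, hR⟩ := exists_clearRange b n
  -- For `n = 0` the result is already in register `b`, and `move b b` would not terminate on a
  -- non-zero value.
  refine ⟨seq P (seq Q (seq R (if n = 0 then skip else move (b + n) b))), fun σ hσ y hy => ?_⟩
  obtain ⟨v, hv, hy⟩ := Part.mem_bind_iff.1 hy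
  have hv' : ∀ i, v.get i ∈ g i (List.Vector.ofFn fun i => σ (ins i)) :=
    mem_of_mem_mOfFn hv
  refine (hP σ hσ (fun j => if h : j < n then v.get ⟨j, h⟩ else 0) ?_).silent_seq
    ((hQ _ ?_ y ?_).silent_seq ((hR _).silent_seq
      (σ₂ := update σ b y) ?_))
  · intro i
    simpa using hv' i
  · intro r hr
    rw [if_neg (by omega)]
    exact hσ r (by omega)
  · convert hy
    ext i
    simp
  · split_ifs with h
    · subst h
      refine (Run.skip _).congr ?_
      ext x
      simp only [Function.update_apply]
      split_ifs <;> first | rfl | omega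
    · refine (run_move _ (by omega)).congr ?_
      ext x
      simp only [Function.update_apply]
      split_ifs <;> first | rfl | omega | simp_all

/-- Register `b` accumulates the value, `b + 1` holds the recursion index, `b + 2` counts down, and
`b + 3` receives the value of `g`. With `k` passes left, `b` and `b + 1` hold `F (N - k)` and `N -
k`. -/
theorem Computes.prec {n : ℕ} {f : List.Vector ℕ n → ℕ} {g : List.Vector ℕ (n + 2) → ℕ}
    (hf : Computes fun v => Part.some (f v)) (hg : Computes fun v => Part.some (g v)) :
    Computes fun v : List.Vector ℕ (n + 1) =>
      Part.some (v.head.rec (f v.tail) fun y IH => g (y ::ᵥ IH ::ᵥ v.tail)) := by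
  intro ins b hb
  obtain ⟨P, hP⟩ := hf (fun i => ins i.succ) b fun i => hb _
  obtain ⟨Q, hQ⟩ := hg (Fin.cons (b + 1) (Fin.cons b fun i => ins i.succ)) (b + 3) fun i => by
    refine Fin.cases (by simp) (fun i => Fin.cases (by simp) (fun i => ?_) i) i
    have := hb i.succ
    simp only [Fin.cons_succ]
    omega
  refine ⟨seq P (seq (copy (ins 0) (b + 2) (b + 3)) (seq (loop (b + 2) (seq (dec (b + 2))
    (seq Q (seq (clear b) (seq (move (b + 3) b) (inc (b + 1))))))) (clear (b + 1)))),
    fun σ hσ y hy => ?_⟩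
  set v := List.Vector.ofFn fun i : Fin n => σ (ins i.succ) with hv
  set F : ℕ → ℕ := fun k => Nat.rec (f v) (fun y IH => g (y ::ᵥ IH ::ᵥ v)) k with hF
  obtain rfl : y = F (σ (ins 0)) := by
    simpa [List.Vector.ofFn, hF, hv] using hy
  have h0 := hb 0
  set N := σ (ins 0)
  have hl := Run.countdown (r := b + 2) (p := seq (dec (b + 2))
    (seq Q (seq (clear b) (seq (move (b + 3) b) (inc (b + 1))))))
    (fun k => update (update (update σ b (F (N - k))) (b + 1) (N - k)) (b + 2) k) (by simp) N ?_
  · refine (hP σ hσ (f v) (by simp [hv])).silent_seq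
      (((run_copy _ (by omega) (by omega) (by omega) ?_ ?_).congr ?_).silent_seq
        (hl.silent_seq ((run_clear _ _).congr ?_)))
    · simpa using hσ (b + 2) (by omega)
    · simpa using hσ (b + 3) (by omega)
    · ext x
      have h1 := hσ (b + 1) (by omega)
      simp only [Function.update_apply]
      split_ifs <;> first | omega | simp_all
    · ext x
      have h1 := hσ (b + 1) (by omega)
      have h2 := hσ (b + 2) (by omega)
      simp only [Function.update_apply]
      split_ifs <;> simp_all
  · intro k hk
    have hq := hQ (update (update (update σ b (F (N - (k + 1)))) (b + 1) (N - (k + 1))) (b + 2) k)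
      (fun r hr => by
        have := hσ r (by omega)
        simp only [Function.update_apply]
        split_ifs <;> first | omega)
      (F (N - k)) (by
        have : N - k = (N - (k + 1)) + 1 := by omega
        simp only [this, hF, List.Vector.ofFn, Fin.cons_zero, Fin.cons_succ]
        simp
        congr 3
        ext i
        have := hb i.succ
        simp only [hv, Function.update_apply, List.Vector.get_ofFn]
        split_ifs <;> first | rfl | omega)
    refine ((Run.dec _ _).congr ?_).silent_seq (hq.silent_seq ((run_clear _ _).silent_seq
      ((run_move _ (by omega)).silent_seq ((Run.inc _ _).congr ?_))))
    · ext x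
      simp only [Function.update_apply]
      split_ifs <;> rfl
    · ext x
      have h3 := hσ (b + 3) (by omega)
      simp only [Function.update_apply]
      split_ifs <;> first | rfl | omega | simp_all

/-- Register `b` holds the candidate and `b + 1` the value of `f` there, which serves as the loop
condition. Termination is by induction on the distance to the least zero `y`; on exit `b + 1` holds
`0`, so no scratch needs clearing. -/
theorem Computes.rfind {n : ℕ} {f : List.Vector ℕ (n + 1) → ℕ}
    (hf : Computes fun v => Part.some (f v)) :
    Computes fun v => Nat.rfind fun n => Part.some (decide (f (n ::ᵥ v) = 0)) := by
  intro ins b hb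
  obtain ⟨P, hP⟩ := hf (Fin.cons b ins) (b + 1) fun i =>
    Fin.cases (by simp) (fun i => (hb i).trans (by simp)) i
  refine ⟨seq P (loop (b + 1) (seq (clear (b + 1)) (seq (inc b) P))), fun σ hσ y hy => ?_⟩
  set v := List.Vector.ofFn fun i : Fin n => σ (ins i) with hv
  have hstep : ∀ j, Run P (update σ b j) [] (update (update σ b j) (b + 1) (f (j ::ᵥ v))) := by
    intro j
    refine hP _ (fun r hr => ?_) _ ?_
    · rw [Function.update_of_ne (by omega)]
      exact hσ r (by omega)
    · simp only [List.Vector.ofFn, Fin.cons_zero, Fin.cons_succ, Part.mem_some_iff,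
        Function.update_self]
      congr 2
      ext i
      have := hb i
      simp only [hv, Function.update_apply, List.Vector.get_ofFn]
      split_ifs <;> first | rfl | omega
  obtain ⟨h1, h2⟩ := Nat.mem_rfind.1 hy
  have hloop : ∀ k ≤ y, Run (loop (b + 1) (seq (clear (b + 1)) (seq (inc b) P)))
      (update (update σ b (y - k)) (b + 1) (f ((y - k) ::ᵥ v))) [] (update σ b y) := by
    intro k
    induction k with
    | zero =>
      intro _
      have h0 : f (y ::ᵥ v) = 0 := by simpa using h1
      refine (Run.loop_done (by simpa using h0)).congr ?_
      ext x
      have := hσ (b + 1) (by omega)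
      simp only [Function.update_apply]
      split_ifs <;> simp_all
    | succ k ih =>
      intro hk
      have h0 : f ((y - (k + 1)) ::ᵥ v) ≠ 0 := by
        simpa using h2 (show y - (k + 1) < y by omega)
      refine Run.loop_step (o₁ := []) (o₂ := []) (by simpa using h0)
        ((run_clear _ _).silent_seq (((Run.inc _ _).congr ?_).silent_seq (hstep (y - k))))
        (ih (by omega))
      ext x
      have := hσ (b + 1) (by omega)
      simp only [Function.update_apply]
      split_ifs <;> first | rfl | omega | simp_all
  have h0 : update σ b 0 = σ := by rw [← hσ b le_rfl, Function.update_eq_self]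
  have := hstep 0
  rw [h0] at this
  refine this.silent_seq ?_
  have := hloop y le_rfl
  rwa [Nat.sub_self, h0] at this

theorem computes_of_primrec' {n : ℕ} {f : List.Vector ℕ n → ℕ} (hf : Nat.Primrec' f) :
    Computes fun v => Part.some (f v) := by
  induction hf with
  | zero => exact computes_zero
  | succ => exact computes_succ
  | get i => exact computes_get i
  | comp g _ _ hf hg => simpa using Computes.comp _ hf hg
  | prec _ _ hf hg => exact hf.prec hg

theorem computes_of_partrec' {n : ℕ} {f : List.Vector ℕ n →. ℕ} (hf : Nat.Partrec' f) :
    Computes f := by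
  induction hf with
  | prim hf => exact computes_of_primrec' hf
  | comp g _ _ hf hg => exact Computes.comp g hf hg
  | rfind _ hf => exact hf.rfind

/-- Output the bit `0` or `1` if the register `2` holds `1` or `2`, and set this register to `0`. -/
def emitBit : RegProg :=
  seq (inc 3) (seq (dec 2) (seq (loop 2 (seq (dec 2) (seq (dec 3) (emit true))))
    (loop 3 (seq (dec 3) (emit false)))))

/-- Register `3` is the flag of an if-then-else: it is set to `1`, and the loop for the bit `1`
lowers it, so exactly one of the two loops runs, exactly once. -/
theorem run_emitBit (σ) (b : Bool) (h2 : σ 2 = 0) (h3 : σ 3 = 0) :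
    Run emitBit (update σ 2 (bif b then 2 else 1)) [b] σ := by
  have e1 : ∀ k, update (update (update σ 2 (k + 1)) 3 1) 2 k = update (update σ 2 k) 3 1 := by
    intro k
    ext x
    simp only [Function.update_apply]
    split_ifs <;> simp_all
  have e2 : update (update (update σ 2 0) 3 1) 3 0 = σ := by
    ext x
    simp only [Function.update_apply]
    split_ifs <;> simp_all
  have start : ∀ k, Run (inc 3) (update σ 2 (k + 1)) [] (update (update σ 2 (k + 1)) 3 1) :=
    fun k => (Run.inc _ _).congr (by simp [h3])
  have hdec2 : ∀ k, Run (dec 2) (update (update σ 2 (k + 1)) 3 1) [] (update (update σ 2 k) 3 1) :=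
    fun k => (Run.dec _ _).congr (by simp [e1])
  have hdec3 : Run (dec 3) (update (update σ 2 0) 3 1) [] σ :=
    (Run.dec _ _).congr (by simp [e2])
  cases b with
  | false =>
    exact (start 0).seq <| (hdec2 0).seq <| (Run.loop_done (by simp)).seq
      (o₁ := []) (o₂ := [false]) <| .loop_step (o₁ := [false]) (by simp)
        (hdec3.seq (.emit false σ)) (.loop_done h3)
  | true =>
    exact (start 1).seq <| (hdec2 1).seq <| Run.seq (o₁ := [true]) (o₂ := [])
      (.loop_step (o₁ := [true]) (by simp) ((hdec2 0).seq (hdec3.seq (.emit true σ)))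
        (.loop_done h2)) (.loop_done h3)

/-- Every computable map from `ℕ` to bit strings is computed by a program that reads the argument
from the register `0` and outputs the string bit by bit. -/
theorem exists_run_of_computable {S : ℕ → List Bool} (hS : Computable S) :
    ∃ P : RegProg, ∀ p : ℕ, ∃ σ, Run P (update 0 0 p) (S p) σ := by
  -- `G` computes the bit number `i` of `S p` shifted by one; the value `0` marks the end of the
  -- string and stops the printing loop.
  obtain ⟨G, hG⟩ := computes_of_partrec' (f := fun v : List.Vector ℕ 2 =>
    Part.some (((S v.head)[v.tail.head]?.map fun b => bif b then 2 else 1).getD 0))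
    (Nat.Partrec'.of_part <| Computable.option_getD (Computable.option_map
      (Computable.list_getElem?.comp (hS.comp .vector_head)
        (Computable.vector_head.comp .vector_tail))
      (Computable.cond .snd (.const 2) (.const 1)).to₂) (.const 0))
    (fun i => i) 2 (fun i => i.2)
  replace hG : ∀ p i, Run G (update (update 0 0 p) 1 i) []
      (update (update (update 0 0 p) 1 i) 2
        (((S p)[i]?.map fun b => bif b then 2 else 1).getD 0)) := by
    intro p i
    refine hG _ (fun r hr => ?_) _ ?_
    · rw [Function.update_of_ne (by omega), Function.update_of_ne (by omega)]
      rfl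
    · simp [List.Vector.ofFn]
  refine ⟨seq G (loop 2 (seq emitBit (seq (inc 1) G))), fun p => ?_⟩
  -- Here `k` is the number of bits that remain to be printed.
  have hloop : ∀ k ≤ (S p).length, ∃ σ, Run (loop 2 (seq emitBit (seq (inc 1) G)))
      (update (update (update 0 0 p) 1 ((S p).length - k)) 2
        (((S p)[(S p).length - k]?.map fun b => bif b then 2 else 1).getD 0))
      ((S p).drop ((S p).length - k)) σ := by
    intro k
    induction k with
    | zero => exact fun _ => ⟨_, by simpa using Run.loop_done (by simp)⟩
    | succ k ih =>
      intro hk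
      obtain ⟨σ, hσ⟩ := ih (by omega)
      have hlt : (S p).length - (k + 1) < (S p).length := by omega
      refine ⟨σ, ?_⟩
      rw [List.drop_eq_getElem_cons hlt, List.getElem?_eq_getElem hlt,
        show (S p).length - (k + 1) + 1 = (S p).length - k by omega]
      refine Run.loop_step (o₁ := [_]) ?_ ((run_emitBit _ _ ?_ ?_).seq
        (((Run.inc _ _).congr ?_).silent_seq (hG p ((S p).length - k)))) hσ
      · simp only [Option.map_some, Option.getD_some, Function.update_self]
        cases (S p)[(S p).length - (k + 1)] <;> simp
      · simp
      · simp
      · ext x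
        simp only [Function.update_apply]
        split_ifs <;> first | rfl | omega
  obtain ⟨σ, hσ⟩ := hloop _ le_rfl
  rw [Nat.sub_self, List.drop_zero] at hσ
  have h0 : update (update (0 : ℕ → ℕ) 0 p) 1 0 = update (0 : ℕ → ℕ) 0 p := by
    exact Function.update_eq_self_iff.2 (by simp)
  have := hG p 0
  rw [h0] at this hσ
  exact ⟨σ, this.seq hσ⟩

end RegProg

/-! ### Compilation to register machines with jumps -/

/-- Instructions of register machines with jumps to absolute addresses. -/
inductive RegInstr
  | inc (r : ℕ)
  | dec (r : ℕ)
  | emit (b : Bool)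
  | jmp (a : ℕ)
  | jz (r a : ℕ)

namespace RegInstr

open Function (update)

/-- The configuration after the execution of an instruction. -/
def exec : RegInstr → ℕ × (ℕ → ℕ) → ℕ × (ℕ → ℕ)
  | inc r, c => (c.1 + 1, update c.2 r (c.2 r + 1))
  | dec r, c => (c.1 + 1, update c.2 r (c.2 r - 1))
  | emit _, c => (c.1 + 1, c.2)
  | jmp a, c => (a, c.2)
  | jz r a, c => (if c.2 r = 0 then a else c.1 + 1, c.2)

/-- The bits that an instruction outputs. -/
def out : RegInstr → List Bool
  | emit b => [b]
  | _ => []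

/-- Execution of a list of instructions, with the bits that are output. -/
inductive Steps (C : List RegInstr) : ℕ × (ℕ → ℕ) → List Bool → ℕ × (ℕ → ℕ) → Prop
  | refl (c) : Steps C c [] c
  | step {c i o c'} : C[c.1]? = some i → Steps C (i.exec c) o c' → Steps C c (i.out ++ o) c'

theorem Steps.trans {C c o c' o' c''} (h : Steps C c o c') (h' : Steps C c' o' c'') :
    Steps C c (o ++ o') c'' := by
  induction h with
  | refl c => exact h'
  | step hi _ ih => exact List.append_assoc _ _ _ ▸ Steps.step hi (ih h')

theorem Steps.single {C c i} (h : C[c.1]? = some i) : Steps C c i.out (i.exec c) :=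
  List.append_nil i.out ▸ Steps.step h (.refl _)

/-- `C` contains the list `D` of instructions at the address `a`. -/
def HasCode (C D : List RegInstr) (a : ℕ) : Prop := ∀ i < D.length, C[a + i]? = D[i]?

theorem HasCode.left {C D E a} (h : HasCode C (D ++ E) a) : HasCode C D a := fun i hi => by
  rw [h i (by simp; omega), List.getElem?_append_left hi]

theorem HasCode.right {C D E a} (h : HasCode C (D ++ E) a) : HasCode C E (a + D.length) :=
  fun i hi => by
    rw [add_assoc, h (D.length + i) (by simp; omega), List.getElem?_append_right (by omega),
      Nat.add_sub_cancel_left]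

theorem HasCode.head {C i D a} (h : HasCode C (i :: D) a) : C[a]? = some i := by
  simpa using h 0 (by simp)

theorem HasCode.tail {C i D a} (h : HasCode C (i :: D) a) : HasCode C D (a + 1) :=
  HasCode.right (D := [i]) h

end RegInstr

namespace RegProg

open RegInstr

/-- The number of instructions of the compiled program. -/
def size : RegProg → ℕ
  | skip => 0
  | inc _ => 1
  | dec _ => 1
  | emit _ => 1
  | seq p q => p.size + q.size
  | loop _ p => p.size + 2

/-- The instructions of a program, to be placed at the address `a`. -/
def compile : RegProg → ℕ → List RegInstr
  | skip, _ => []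
  | inc r, _ => [.inc r]
  | dec r, _ => [.dec r]
  | emit b, _ => [.emit b]
  | seq p q, a => p.compile a ++ q.compile (a + p.size)
  | loop r p, a => .jz r (a + p.size + 2) :: (p.compile (a + 1) ++ [.jmp a])

theorem length_compile : ∀ (p : RegProg) (a : ℕ), (p.compile a).length = p.size
  | skip, _ => rfl
  | inc _, _ => rfl
  | dec _, _ => rfl
  | emit _, _ => rfl
  | seq p q, a => by simp [compile, size, length_compile p, length_compile q]
  | loop r p, a => by simp [compile, size, length_compile p]

/-- The listing `C` is arbitrary apart from containing the code at its address, so the induction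
hypotheses apply to subprograms in place. The closing jump of a loop returns to its own test at `a`.
-/
theorem Run.steps {C p σ o σ'} (h : Run p σ o σ') :
    ∀ a, HasCode C (p.compile a) a → Steps C (a, σ) o (a + p.size, σ') := by
  induction h with
  | skip => exact fun a _ => .refl _
  | inc r σ => exact fun a h => Steps.single (c := (a, σ)) h.head
  | dec r σ => exact fun a h => Steps.single (c := (a, σ)) h.head
  | emit b σ => exact fun a h => Steps.single (c := (a, σ)) h.head
  | seq _ _ ih₁ ih₂ =>
    intro a h
    refine (ih₁ a h.left).trans ?_
    have := h.right
    rw [length_compile] at this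
    simpa [size, add_assoc] using ih₂ _ this
  | @loop_done r p σ h0 =>
    intro a h
    simpa [exec, h0, size, out, add_assoc] using Steps.single (c := (a, σ)) h.head
  | @loop_step r p σ σ₁ σ₂ o₁ o₂ h0 _ _ ih₁ ih₂ =>
    intro a h
    have h1 := Steps.single (c := (a, σ)) h.head
    have h3 : Steps C (a + 1 + p.size, σ₁) [] (a, σ₁) := by
      refine Steps.single (c := (a + 1 + p.size, σ₁)) (i := .jmp a) ?_
      have := h.tail.right.head
      rwa [length_compile] at this
    have := ((h1.trans ((by simpa [exec, h0] using ih₁ (a + 1) h.tail.left))).trans h3).trans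
      (ih₂ a h)
    simpa [out] using this

/-- Increment the register `0` a given number of times. -/
def incs : ℕ → RegProg
  | 0 => skip
  | n + 1 => seq (incs n) (inc 0)

theorem run_incs : ∀ n, Run (incs n) 0 [] (Function.update 0 0 n)
  | 0 => (Run.skip _).congr (by simp)
  | n + 1 => ((run_incs n).silent_seq (.inc _ _)).congr (by simp)

theorem size_incs : ∀ n, (incs n).size = n
  | 0 => rfl
  | n + 1 => by rw [incs, size, size_incs n, size]

/-- The registers of a program are below a number. -/
def RegsLT (m : ℕ) : RegProg → Prop
  | skip => True
  | inc r => r < m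
  | dec r => r < m
  | emit _ => True
  | seq p q => p.RegsLT m ∧ q.RegsLT m
  | loop r p => r < m ∧ p.RegsLT m

theorem RegsLT.mono {m n : ℕ} (h : m ≤ n) : ∀ {p : RegProg}, p.RegsLT m → p.RegsLT n
  | skip, _ => trivial
  | inc _, hp => lt_of_lt_of_le hp h
  | dec _, hp => lt_of_lt_of_le hp h
  | emit _, _ => trivial
  | seq _ _, hp => ⟨hp.1.mono h, hp.2.mono h⟩
  | loop _ _, hp => ⟨lt_of_lt_of_le hp.1 h, hp.2.mono h⟩

theorem exists_regsLT : ∀ p : RegProg, ∃ m, p.RegsLT m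
  | skip => ⟨0, trivial⟩
  | inc r => ⟨r + 1, r.lt_succ_self⟩
  | dec r => ⟨r + 1, r.lt_succ_self⟩
  | emit _ => ⟨0, trivial⟩
  | seq p q => by
    obtain ⟨m, hm⟩ := exists_regsLT p
    obtain ⟨n, hn⟩ := exists_regsLT q
    exact ⟨max m n, hm.mono (le_max_left _ _), hn.mono (le_max_right _ _)⟩
  | loop r p => by
    obtain ⟨m, hm⟩ := exists_regsLT p
    exact ⟨max (r + 1) m, Nat.lt_of_succ_le (le_max_left _ _), hm.mono (le_max_right _ _)⟩

theorem regsLT_incs : ∀ n, (incs n).RegsLT 1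
  | 0 => trivial
  | n + 1 => ⟨regsLT_incs n, Nat.one_pos⟩

end RegProg

namespace RegInstr

/-- The registers of an instruction are below a number. -/
def RegsLT (m : ℕ) : RegInstr → Prop
  | inc r => r < m
  | dec r => r < m
  | emit _ => True
  | jmp _ => True
  | jz r _ => r < m

theorem _root_.RegProg.RegsLT.compile {m : ℕ} :
    ∀ {p : RegProg}, p.RegsLT m → ∀ a, ∀ i ∈ p.compile a, i.RegsLT m
  | .skip, _, _ => by simp [RegProg.compile]
  | .inc _, hp, _ => by simpa [RegProg.compile, RegsLT, RegProg.RegsLT] using hp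
  | .dec _, hp, _ => by simpa [RegProg.compile, RegsLT, RegProg.RegsLT] using hp
  | .emit _, _, _ => by simp [RegProg.compile, RegsLT]
  | .seq _ _, hp, a => by
    intro i hi
    exact (List.mem_append.1 hi).elim (hp.1.compile _ i) (hp.2.compile _ i)
  | .loop _ _, hp, a => by
    simp only [RegProg.compile, List.mem_cons, List.mem_append, List.not_mem_nil, or_false]
    rintro i (rfl | hi | rfl)
    exacts [hp.1, hp.2.compile _ i hi, trivial]

/-- For a computable family of bit strings, machines of linear size with a bounded number of
registers. -/
theorem exists_steps_of_computable {S : ℕ → List Bool} (hS : Computable S) :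
    ∃ m c : ℕ, ∀ p : ℕ, ∃ C : List RegInstr, C.length = p + c ∧ (∀ i ∈ C, i.RegsLT m) ∧
      ∃ σ, Steps C (0, 0) (S p) (C.length, σ) := by
  obtain ⟨P, hP⟩ := RegProg.exists_run_of_computable hS
  obtain ⟨m, hm⟩ := P.exists_regsLT
  -- Only the `p` increments that load the argument depend on `p`; the rest has constant size.
  refine ⟨max 1 m, P.size, fun p => ⟨((RegProg.incs p).seq P).compile 0, ?_, ?_, ?_⟩⟩
  · rw [RegProg.length_compile, RegProg.size, RegProg.size_incs]
  · exact RegProg.RegsLT.compile (p := (RegProg.incs p).seq P)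
      ⟨(RegProg.regsLT_incs p).mono (le_max_left _ _),
      hm.mono (le_max_right _ _)⟩ 0
  · obtain ⟨σ, hσ⟩ := hP p
    have := ((RegProg.run_incs p).seq hσ).steps (C := ((RegProg.incs p).seq P).compile 0) 0
      (fun i _ => by rw [zero_add])
    rw [zero_add] at this
    exact ⟨σ, by rw [RegProg.length_compile]; exact this⟩

end RegInstr

/-! ### Looped networks with weights in `{-δ, 0, δ}` -/

section TernaryNets

/-- When `M < 2 * δ`, these are the only representable values, so the simulation is restricted to
them. -/
theorem mul_mem_fixedPrecisionValues {δ M : ℝ} (hδ : 0 < δ) (hM : δ ≤ M) {k : ℤ} (hk : |k| ≤ 1) :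
    δ * k ∈ fixedPrecisionValues δ M := by
  refine ⟨⟨k, rfl⟩, Set.mem_Icc.2 (abs_le.1 ?_)⟩
  rw [abs_mul, abs_of_pos hδ]
  have : |(k : ℝ)| ≤ 1 := by exact_mod_cast hk
  nlinarith

theorem AffineLayer.numNonzero_le {m n : ℕ} (A : AffineLayer m n) : A.numNonzero ≤ n * m + n := by
  refine Nat.add_le_add ((Finset.card_filter_le _ _).trans_eq ?_)
    ((Finset.card_filter_le _ _).trans_eq ?_) <;> simp

/-- The states of a looped network whose block has one hidden layer with weights in `{-δ, 0, δ}`: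
the hidden neurons are indexed by `η`, with `k` copies of each, and the state coordinates by
`Fin 3 ⊕ κ`. The first three coordinates are not read. -/
noncomputable def ternaryState {κ η : Type*} [Fintype κ] [Fintype η] (δ : ℝ) (k : ℕ)
    (U : η → κ → ℤ) (β : η → ℤ) (V : Fin 3 ⊕ κ → η → ℤ) : ℕ → Fin 3 ⊕ κ → ℝ
  | 0, _ => 0
  | t + 1, j => k * δ * ∑ h, V j h *
      max (δ * (∑ i, U h i * ternaryState δ k U β V t (.inr i) + β h)) 0

/-- Repeating a neuron `k` times replaces its output weight `δ` by `k * δ`, which gives the block a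
gain of `k * δ ^ 2` although no single weight may exceed `δ`. The size bound simply counts all
entries of both layers. -/
theorem exists_ternaryNet {κ η : Type*} [Fintype κ] [Fintype η] {δ M : ℝ} (hδ : 0 < δ)
    (hM : δ ≤ M) (k : ℕ) (U : η → κ → ℤ) (β : η → ℤ) (V : Fin 3 ⊕ κ → η → ℤ)
    (hU : ∀ h i, |U h i| ≤ 1) (hβ : ∀ h, |β h| ≤ 1) (hV : ∀ j h, |V j h| ≤ 1) :
    ∃ N : LoopedNet, N.block.IsFixedPrecision δ M ∧
      N.block.numNonzero ≤ 2 * (Fintype.card η * k + 1) * (3 + Fintype.card κ + 1) ∧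
      ∀ t, N.halt t = ternaryState δ k U β V t (.inl 0) ∧
        N.emit t = ternaryState δ k U β V t (.inl 1) ∧
        N.bit t = ternaryState δ k U β V t (.inl 2) := by
  classical
  let e : Fin 3 ⊕ κ ≃ Fin (3 + Fintype.card κ) :=
    (Equiv.sumCongr (Equiv.refl _) (Fintype.equivFin κ)).trans finSumFinEquiv
  let w : η × Fin k ≃ Fin (Fintype.card η * k) :=
    (Fintype.equivFinOfCardEq (by simp))
  let A : AffineLayer (3 + Fintype.card κ) (Fintype.card η * k) :=
    { weight := fun h i => δ * ((Sum.elim (fun _ => 0) (U (w.symm h).1) (e.symm i) : ℤ) : ℝ)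
      bias := fun h => δ * (β (w.symm h).1 : ℝ) }
  let B : AffineLayer (Fintype.card η * k) (3 + Fintype.card κ) :=
    { weight := fun j h => δ * (V (e.symm j) (w.symm h).1 : ℝ)
      bias := 0 }
  let N : LoopedNet := ⟨3 + Fintype.card κ, by omega, .cons A (.last B)⟩
  have hstate : ∀ t j, N.state t (e j) = ternaryState δ k U β V t j := by
    intro t
    induction t with
    | zero => intro j; rfl
    | succ t ih =>
      intro j
      have h1 : N.state (t + 1) = N.block.eval (N.state t) := Function.iterate_succ_apply' _ _ _
      have hA : ∀ h, A.eval (N.state t) (w h) =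
          δ * (∑ i, U h.1 i * ternaryState δ k U β V t (.inr i) + β h.1) := by
        intro h
        have : A.eval (N.state t) (w h) =
          ∑ i, A.weight (w h) i * N.state t i + A.bias (w h) := rfl
        rw [this, ← e.sum_comp, Fintype.sum_sum_type]
        simp only [ih]
        simp [A, mul_add, Finset.mul_sum, mul_assoc]
      rw [h1]
      have : N.block.eval (N.state t) (e j) =
        ∑ h, B.weight (e j) h * max (A.eval (N.state t) h) 0 + B.bias (e j) := rfl
      rw [this, ← w.sum_comp, ternaryState]
      simp only [hA]
      rw [Fintype.sum_prod_type]
      simp [B, Finset.mul_sum, mul_assoc]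
  refine ⟨N, ⟨⟨fun h i => mul_mem_fixedPrecisionValues hδ hM ?_,
    fun h => mul_mem_fixedPrecisionValues hδ hM (hβ _)⟩,
    ⟨fun j h => mul_mem_fixedPrecisionValues hδ hM (hV _ _), fun j => ?_⟩⟩, ?_, fun t => ?_⟩
  · cases e.symm i <;> simp [hU]
  · have := mul_mem_fixedPrecisionValues hδ hM (k := 0) (by simp)
    rwa [Int.cast_zero, mul_zero] at this
  · have h1 := A.numNonzero_le
    have h2 := B.numNonzero_le
    change A.numNonzero + B.numNonzero ≤ _
    nlinarith
  · refine ⟨hstate t (.inl 0), hstate t (.inl 1), hstate t (.inl 2)⟩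

end TernaryNets

/-! ### Simulation of a register machine by a looped network -/

namespace RegInstr

variable (C : List RegInstr) (m : ℕ)

/-- `1` if the instruction decrements the register `j`. -/
def decCoeff (j : ℕ) : Option RegInstr → ℤ
  | some (dec r) => if r = j then 1 else 0
  | _ => 0

/-- `1` if the instruction increments the register `j`. -/
def incCoeff (j : ℕ) : Option RegInstr → ℤ
  | some (inc r) => if r = j then 1 else 0
  | _ => 0

/-- `1` if the instruction outputs a bit. -/
def emitCoeff : Option RegInstr → ℤ
  | some (emit _) => 1
  | _ => 0

/-- `1` if the instruction outputs the bit `1`. -/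
def bitCoeff : Option RegInstr → ℤ
  | some (emit true) => 1
  | _ => 0

/-- `1` if the instruction at the address `i` continues at the address `k` by default. -/
def nextCoeff (i k : ℕ) : Option RegInstr → ℤ
  | some (jmp a) => if a = k then 1 else 0
  | some _ => if i + 1 = k then 1 else 0
  | none => 0

/-- The correction to `nextCoeff` when a conditional jump is taken. -/
def jumpCoeff (i k : ℕ) : Option RegInstr → ℤ
  | some (jz _ a) => (if a = k then 1 else 0) - (if i + 1 = k then 1 else 0)
  | _ => 0

/-- `1` if the instruction is a conditional jump on the register `j`. -/
def testCoeff (j : ℕ) : Option RegInstr → ℤ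
  | some (jz r _) => if r = j then 1 else 0
  | _ => 0

/-- `1` if the instruction is a conditional jump. -/
def isJzCoeff : Option RegInstr → ℤ
  | some (jz _ _) => 1
  | _ => 0

/-- Coordinates of a machine configuration: a unit, the registers, the addresses. -/
abbrev Coord := Unit ⊕ Fin m ⊕ Fin (C.length + 1)

/-- Hidden neurons: the detector of the zero state, the unit, the registers, the addresses, and the
conditional jumps taken. -/
abbrev Hidden := Unit ⊕ Unit ⊕ Fin m ⊕ Fin (C.length + 1) ⊕ Fin (C.length + 1)

/-- Input weights of the network that simulates a machine. -/
def inWeight : Hidden C m → Coord C m → ℤ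
  | .inl _, .inl _ => -1
  | .inl _, .inr _ => 0
  | .inr (.inl _), .inl _ => 1
  | .inr (.inl _), .inr _ => 0
  | .inr (.inr (.inl _)), .inl _ => 0
  | .inr (.inr (.inl j)), .inr (.inl j') => if j = j' then 1 else 0
  | .inr (.inr (.inl j)), .inr (.inr i) => - decCoeff j C[(i : ℕ)]?
  | .inr (.inr (.inr (.inl _))), .inl _ => 0
  | .inr (.inr (.inr (.inl _))), .inr (.inl _) => 0
  | .inr (.inr (.inr (.inl i))), .inr (.inr i') => if i = i' then 1 else 0
  | .inr (.inr (.inr (.inr _))), .inl _ => 0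
  | .inr (.inr (.inr (.inr i))), .inr (.inl j) => - testCoeff j C[(i : ℕ)]?
  | .inr (.inr (.inr (.inr i))), .inr (.inr i') => if i = i' then isJzCoeff C[(i : ℕ)]? else 0

/-- Biases of the hidden neurons. -/
def hiddenBias : Hidden C m → ℤ
  | .inl _ => 1
  | .inr _ => 0

/-- Output weights of the network that simulates a machine. -/
def outWeight : Fin 3 ⊕ Coord C m → Hidden C m → ℤ
  | .inl c, .inr (.inr (.inr (.inl i))) =>
      ![if (i : ℕ) = C.length then 1 else 0, emitCoeff C[(i : ℕ)]?, bitCoeff C[(i : ℕ)]?] c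
  | .inr (.inl _), .inl _ => 1
  | .inr (.inl _), .inr (.inl _) => 1
  | .inr (.inr (.inl j)), .inr (.inr (.inl j')) => if j = j' then 1 else 0
  | .inr (.inr (.inl j)), .inr (.inr (.inr (.inl i))) => incCoeff j C[(i : ℕ)]?
  | .inr (.inr (.inr k)), .inl _ => if (k : ℕ) = 0 then 1 else 0
  | .inr (.inr (.inr k)), .inr (.inr (.inr (.inl i))) => nextCoeff i k C[(i : ℕ)]?
  | .inr (.inr (.inr k)), .inr (.inr (.inr (.inr i))) => jumpCoeff i k C[(i : ℕ)]?
  | _, _ => 0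

theorem abs_ite_le (p : Prop) [Decidable p] : |if p then (1 : ℤ) else 0| ≤ 1 := by
  split_ifs <;> simp

theorem abs_decCoeff_le (j : ℕ) (o : Option RegInstr) : |decCoeff j o| ≤ 1 := by
  unfold decCoeff
  split
  exacts [abs_ite_le _, by simp]

theorem abs_incCoeff_le (j : ℕ) (o : Option RegInstr) : |incCoeff j o| ≤ 1 := by
  unfold incCoeff
  split
  exacts [abs_ite_le _, by simp]

theorem abs_emitCoeff_le (o : Option RegInstr) : |emitCoeff o| ≤ 1 := by
  unfold emitCoeff
  split <;> simp

theorem abs_bitCoeff_le (o : Option RegInstr) : |bitCoeff o| ≤ 1 := by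
  unfold bitCoeff
  split <;> simp

theorem abs_nextCoeff_le (i k : ℕ) (o : Option RegInstr) : |nextCoeff i k o| ≤ 1 := by
  unfold nextCoeff
  split
  exacts [abs_ite_le _, abs_ite_le _, by simp]

theorem abs_jumpCoeff_le (i k : ℕ) (o : Option RegInstr) : |jumpCoeff i k o| ≤ 1 := by
  unfold jumpCoeff
  split
  · split_ifs <;> simp
  · simp

theorem abs_testCoeff_le (j : ℕ) (o : Option RegInstr) : |testCoeff j o| ≤ 1 := by
  unfold testCoeff
  split
  exacts [abs_ite_le _, by simp]

theorem abs_isJzCoeff_le (o : Option RegInstr) : |isJzCoeff o| ≤ 1 := by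
  unfold isJzCoeff
  split <;> simp

theorem abs_inWeight_le (h : Hidden C m) (i : Coord C m) : |inWeight C m h i| ≤ 1 := by
  unfold inWeight
  split <;> (try split) <;>
    simp [abs_decCoeff_le, abs_testCoeff_le, abs_isJzCoeff_le]

theorem abs_hiddenBias_le (h : Hidden C m) : |hiddenBias C m h| ≤ 1 := by
  unfold hiddenBias
  split <;> simp

theorem abs_outWeight_le (j : Fin 3 ⊕ Coord C m) (h : Hidden C m) : |outWeight C m j h| ≤ 1 := by
  unfold outWeight
  split
  · rename_i c i
    fin_cases c
    exacts [abs_ite_le _, abs_emitCoeff_le _, abs_bitCoeff_le _]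
  · simp
  · simp
  · exact abs_ite_le _
  · exact abs_incCoeff_le _ _
  · exact abs_ite_le _
  · exact abs_nextCoeff_le _ _ _
  · exact abs_jumpCoeff_le _ _ _
  · simp

/-- The representation of a configuration at the scale `l`. -/
def enc (l : ℝ) (c : ℕ × (ℕ → ℕ)) : Coord C m → ℝ
  | .inl _ => l
  | .inr (.inl j) => l * c.2 j
  | .inr (.inr i) => if c.1 = i then l else 0

/-- The values of the hidden neurons, up to scale. -/
def hiddenVal (c : ℕ × (ℕ → ℕ)) : Hidden C m → ℤ
  | .inl _ => 0
  | .inr (.inl _) => 1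
  | .inr (.inr (.inl j)) => max (c.2 j - decCoeff j C[c.1]?) 0
  | .inr (.inr (.inr (.inl i))) => if c.1 = i then 1 else 0
  | .inr (.inr (.inr (.inr i))) => if c.1 = i then
      (match C[c.1]? with
        | some (jz r _) => if c.2 r = 0 then 1 else 0
        | _ => 0) else 0

/-- All preactivations but one are `δ * l` times an integer, and ReLU commutes with the positive
factor. The exception is the zero-state detector, whose bias is not scaled: it is silent because `1
- l ≤ 0`, which is why the scale must stay at least `1`. -/
theorem hidden_eq {δ l : ℝ} (hδ : 0 < δ) (hl : 1 ≤ l) (pc : Fin (C.length + 1)) (σ : ℕ → ℕ)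
    (hm : ∀ i ∈ C, i.RegsLT m) (h : Hidden C m) :
    max (δ * (∑ i, inWeight C m h i * enc C m l (pc, σ) i + hiddenBias C m h)) 0 =
      δ * l * hiddenVal C m (pc, σ) h := by
  have key : ∀ z : ℤ,
      ∑ i, inWeight C m h i * enc C m l (pc, σ) i + hiddenBias C m h = l * z →
      max z 0 = hiddenVal C m (pc, σ) h →
      max (δ * (∑ i, inWeight C m h i * enc C m l (pc, σ) i + hiddenBias C m h)) 0 =
        δ * l * hiddenVal C m (pc, σ) h := by
    intro z h1 h2
    rw [h1, ← h2, ← mul_assoc, Int.cast_max, Int.cast_zero, mul_max_of_nonneg _ _ (by positivity),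
      mul_zero]
  rcases h with _ | _ | j | i | i
  · have : δ * (∑ i, inWeight C m (.inl ()) i * enc C m l (pc, σ) i +
        hiddenBias C m (.inl ())) ≤ 0 := by
      simp only [Fintype.sum_sum_type, inWeight, enc, hiddenBias]
      simp
      nlinarith
    simpa [hiddenVal] using this
  · refine key 1 ?_ rfl
    simp [Fintype.sum_sum_type, inWeight, enc, hiddenBias]
  · refine key (σ j - decCoeff j C[(pc : ℕ)]?) ?_ rfl
    simp [Fintype.sum_sum_type, inWeight, enc, hiddenBias, Fin.val_inj]
    ring
  · refine key (if pc = i then 1 else 0) ?_ ?_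
    · simp [Fintype.sum_sum_type, inWeight, enc, hiddenBias, Fin.val_inj, eq_comm]
    · simp only [hiddenVal, Fin.val_inj]
      split_ifs <;> rfl
  -- The jump neuron of address `i` is a conjunction: `1` for being at a conditional jump, minus the
  -- tested register. As registers hold natural numbers, the positive part is `1` exactly when the
  -- jump is taken, and `0` otherwise.
  · refine key ((if pc = i then isJzCoeff C[(i : ℕ)]? else 0) -
      ∑ j : Fin m, testCoeff j C[(i : ℕ)]? * σ j) ?_ ?_
    · simp [Fintype.sum_sum_type, inWeight, enc, hiddenBias, Fin.val_inj, mul_sub,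
        Finset.mul_sum]
      rw [neg_add_eq_sub]
      congr 1
      · simp [eq_comm, mul_comm]
      · exact Finset.sum_congr rfl fun _ _ => by ring
    · have hsum : ∑ j : Fin m, testCoeff j C[(i : ℕ)]? * σ j =
          (match C[(i : ℕ)]? with | some (jz r _) => (σ r : ℤ) | _ => 0) := by
        unfold testCoeff
        split
        · rename_i r a hi
          have hr : r < m := hm _ (List.mem_of_getElem? hi)
          rw [Finset.sum_eq_single ⟨r, hr⟩] <;> simp
          intro b hb
          simp [Fin.ext_iff] at hb
          intro h
          exact absurd h.symm hb
        · simp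
      rw [hsum]
      simp only [hiddenVal, Fin.val_inj, isJzCoeff]
      split_ifs with hpi
      · subst hpi
        split
        · rename_i r a _
          have := Int.natCast_nonneg (σ r)
          split_ifs with h0
          · simp [h0]
          · exact max_eq_right (by omega)
        · rfl
      · split <;> simp

/-- Decrements were already performed, with truncation at `0`, by the hidden ReLU, so the output
layer only adds increments. The program counter gets its default successor, corrected by `jumpCoeff`
when the jump neuron fires. -/
theorem sum_outWeight_inr (pc : Fin (C.length + 1)) (σ : ℕ → ℕ) {ins : RegInstr}
    (hi : C[(pc : ℕ)]? = some ins) (l : ℝ) (j : Coord C m) :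
    l * (∑ h, outWeight C m (.inr j) h * hiddenVal C m (pc, σ) h : ℤ) =
      enc C m l (ins.exec (pc, σ)) j := by
  rcases j with _ | j | k
  · simp [Fintype.sum_sum_type, outWeight, hiddenVal, enc]
  · have : ∑ h, outWeight C m (.inr (.inr (.inl j))) h * hiddenVal C m (pc, σ) h =
        max (σ j - decCoeff j (some ins)) 0 + incCoeff j (some ins) := by
      simp [Fintype.sum_sum_type, outWeight, hiddenVal, Fin.val_inj, hi]
    rw [this, enc]
    rw [← Int.cast_natCast ((ins.exec (pc, σ)).2 j)]
    congr 2
    have := Int.natCast_nonneg (σ j)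
    rcases ins with r | r | b | a | ⟨r, a⟩ <;>
      simp only [decCoeff, incCoeff, exec, Function.update_apply, eq_comm (a := (j : ℕ))]
    · split_ifs with h
      · subst h; push_cast; omega
      · simp
    · split_ifs with h
      · subst h; omega
      · simp
    all_goals (simp; try rfl)
  · have : ∑ h, outWeight C m (.inr (.inr (.inr k))) h * hiddenVal C m (pc, σ) h =
        nextCoeff pc k (some ins) + jumpCoeff pc k (some ins) *
          (match (some ins) with
            | some (jz r _) => if σ r = 0 then 1 else 0
            | _ => 0) := by
      simp [Fintype.sum_sum_type, outWeight, hiddenVal, Fin.val_inj, hi]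
    rw [this, enc]
    rcases ins with r | r | b | a | ⟨r, a⟩ <;>
      simp only [nextCoeff, jumpCoeff, exec]
    on_goal 5 => by_cases h0 : σ r = 0 <;> simp [h0]
    all_goals (simp; try rfl)

theorem sum_outWeight_inl (pc : Fin (C.length + 1)) (σ : ℕ → ℕ) (c : Fin 3) :
    ∑ h, outWeight C m (.inl c) h * hiddenVal C m (pc, σ) h =
      ![if (pc : ℕ) = C.length then 1 else 0, emitCoeff C[(pc : ℕ)]?, bitCoeff C[(pc : ℕ)]?] c := by
  simp [Fintype.sum_sum_type, outWeight, hiddenVal, Fin.val_inj]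

/-- A machine is simulated by a looped network. -/
theorem exists_net_outputs {δ M : ℝ} (hδ : 0 < δ) (hM : δ ≤ M) (k : ℕ) (hk : 1 ≤ k * δ ^ 2)
    (hm : ∀ i ∈ C, i.RegsLT m) {s : List Bool} {σ' : ℕ → ℕ}
    (h : Steps C (0, 0) s (C.length, σ')) :
    ∃ N : LoopedNet, N.block.IsFixedPrecision δ M ∧ N.Outputs s ∧
      N.block.numNonzero ≤ 2 * ((2 * C.length + m + 4) * k + 1) * (C.length + m + 6) := by
  obtain ⟨N, hN, hcard, hch⟩ := exists_ternaryNet hδ hM k (inWeight C m) (hiddenBias C m)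
    (outWeight C m) (abs_inWeight_le C m) (abs_hiddenBias_le C m) (abs_outWeight_le C m)
  set X := ternaryState δ k (inWeight C m) (hiddenBias C m) (outWeight C m) with hX
  -- On the zero state only the detector fires; its output weights write the initial configuration
  -- at the scale `k * δ ^ 2` and leave the three channels at `0`.
  have hstart : ∀ j, X 1 j = k * δ ^ 2 * outWeight C m j (.inl ()) := by
    intro j
    simp [hX, ternaryState, Fintype.sum_sum_type, hiddenBias, hδ.le]
    ring
  have hX1 : ∀ j, X 1 (.inr j) = enc C m (k * δ ^ 2) (0, 0) j := by
    intro j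
    rw [hstart]
    rcases j with _ | j | i <;> simp [outWeight, enc, eq_comm]
  have hnext : ∀ t l (pc : Fin (C.length + 1)) σ, 1 ≤ l →
      (∀ j, X t (.inr j) = enc C m l (pc, σ) j) →
      ∀ j, X (t + 1) j = (k * δ ^ 2 * l) *
        (∑ h, outWeight C m j h * hiddenVal C m (pc, σ) h : ℤ) := by
    intro t l pc σ hl ht j
    rw [hX, ternaryState, ← hX]
    simp only [ht, hidden_eq C m hδ hl pc σ hm]
    push_cast
    rw [Finset.mul_sum, Finset.mul_sum]
    exact Finset.sum_congr rfl fun _ _ => by ring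
  -- Each machine step is one iteration and multiplies the scale by `k * δ ^ 2 ≥ 1`. A bit output by
  -- the instruction executed at time `t` shows in the channels at time `t + 1`.
  have hrun : ∀ c o c', Steps C c o c' → ∀ t l, 1 ≤ l → (∀ j, X t (.inr j) = enc C m l c j) →
      ¬ 0 < X t (.inl 0) → ∃ d, ∃ l' ≥ 1, (∀ j, X (t + d) (.inr j) = enc C m l' c' j) ∧
        N.emitted (t + d) = N.emitted t ++ o ∧ ∀ e ≤ d, ¬ 0 < X (t + e) (.inl 0) := by
    intro c o c' hs
    induction hs with
    | refl c =>
      intro t l hl ht h0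
      exact ⟨0, l, hl, ht, by simp, fun e he => by rwa [Nat.le_zero.1 he]⟩
    | @step c i o c' hi _ ih =>
      intro t l hl ht h0
      obtain ⟨pc, σ⟩ := c
      have hlt : pc < C.length := (List.getElem?_eq_some_iff.1 hi).1
      have hn := hnext t l ⟨pc, by omega⟩ σ hl ht
      have hl' : 1 ≤ k * δ ^ 2 * l := by nlinarith
      have hpos : 0 < k * δ ^ 2 * l := by linarith
      have hh : ¬ 0 < X (t + 1) (.inl 0) := by
        rw [hn, sum_outWeight_inl]
        simp [hlt.ne]
      have he : N.emitted (t + 1) = N.emitted t ++ i.out := by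
        rw [LoopedNet.emitted, (hch _).2.1, (hch _).2.2, hn, hn, sum_outWeight_inl,
          sum_outWeight_inl]
        have hi' : C[pc]? = some i := hi
        rcases i with r | r | (_ | _) | a | ⟨r, a⟩ <;>
          simp [hi', emitCoeff, bitCoeff, out, -mul_pos_iff_of_pos_left, hpos]
      obtain ⟨d, l', h1, h2, h3, h4⟩ := ih (t + 1) _ hl' (fun j => by
        rw [hn, sum_outWeight_inr C m ⟨pc, by omega⟩ σ hi]) hh
      refine ⟨d + 1, l', h1, ?_, ?_, ?_⟩
      · rwa [add_comm d, ← add_assoc]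
      · rw [add_comm d, ← add_assoc, h3, he, List.append_assoc]
      · intro e hed
        rcases e with _ | e
        · exact h0
        · rw [add_comm e, ← add_assoc]
          exact h4 e (by omega)
  obtain ⟨d, l, hl, h1, h2, h3⟩ := hrun _ _ _ h 1 (k * δ ^ 2) hk hX1 (by simp [hstart, outWeight])
  have hpos : 0 < k * δ ^ 2 * l := by nlinarith
  -- The final address is reached in the state `1 + d`, so the halt channel fires one iteration
  -- later.
  refine ⟨N, hN, ⟨1 + d, ?_, ?_, ?_⟩, ?_⟩
  · rw [(hch _).1, hnext _ l (Fin.last _) σ' hl h1, sum_outWeight_inl]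
    simpa using hpos
  · intro t ht htd
    rw [(hch _).1]
    obtain ⟨e, rfl⟩ := Nat.exists_eq_add_of_le ht
    exact h3 e (by omega)
  · rw [h2, LoopedNet.emitted, (hch _).2.1, zero_add, hstart]
    simp [outWeight, LoopedNet.emitted]
  · refine hcard.trans (le_of_eq ?_)
    simp
    ring

end RegInstr

/-! ### Normal form: constant width and bounded depth -/

/-- Two looped networks whose output channels agree have the same outputs. -/
theorem LoopedNet.Outputs.of_eq {N N' : LoopedNet} {s : List Bool} (h : N.Outputs s)
    (hh : ∀ t, N'.halt t = N.halt t) (he : ∀ t, N'.emit t = N.emit t)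
    (hb : ∀ t, N'.bit t = N.bit t) : N'.Outputs s := by
  have hem : ∀ t, N'.emitted t = N.emitted t := by
    intro t
    induction t with
    | zero => rfl
    | succ t ih => simp only [LoopedNet.emitted, ih, he, hb]
  simpa only [LoopedNet.Outputs, hh, hem] using h

theorem LoopedNet.Outputs.unique {N : LoopedNet} {s s' : List Bool} (h : N.Outputs s)
    (h' : N.Outputs s') : s = s' := by
  obtain ⟨τ, h1, h2, rfl⟩ := h
  obtain ⟨τ', h1', h2', rfl⟩ := h'
  have h3 : τ ≤ τ' := by
    by_contra! hlt
    exact h2 (τ' + 1) (by omega) (by omega) h1'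
  have h4 : τ' ≤ τ := by
    by_contra! hlt
    exact h2' (τ + 1) (by omega) (by omega) h1
  rw [le_antisymm h3 h4]

namespace FeedforwardNet

/-- The network of constant width with the layers `A 0, …, A n`. -/
def ofFn {D : ℕ} : ℕ → (ℕ → AffineLayer D D) → FeedforwardNet D D
  | 0, A => .last (A 0)
  | n + 1, A => .cons (A 0) (ofFn n fun l => A (l + 1))

/-- The values of the neurons before the layer `l`. -/
noncomputable def hiddenState {D : ℕ} (A : ℕ → AffineLayer D D) (x : Fin D → ℝ) : ℕ → Fin D → ℝ
  | 0 => x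
  | l + 1 => fun i => max ((A l).eval (hiddenState A x l) i) 0

theorem hiddenState_shift {D : ℕ} (A : ℕ → AffineLayer D D) (x : Fin D → ℝ) :
    ∀ l, hiddenState (fun l => A (l + 1)) (hiddenState A x 1) l = hiddenState A x (l + 1)
  | 0 => rfl
  | l + 1 => by
    rw [hiddenState, hiddenState_shift A x l]
    rfl

theorem eval_ofFn {D : ℕ} : ∀ (n : ℕ) (A : ℕ → AffineLayer D D) (x : Fin D → ℝ),
    (ofFn n A).eval x = (A n).eval (hiddenState A x n)
  | 0, _, _ => rfl
  | n + 1, A, x => by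
    rw [ofFn, eval]
    exact (eval_ofFn n _ _).trans (congrArg _ (hiddenState_shift A x n))

theorem isFixedPrecision_ofFn {D : ℕ} {δ M : ℝ} : ∀ {n : ℕ} {A : ℕ → AffineLayer D D},
    (ofFn n A).IsFixedPrecision δ M ↔ ∀ l ≤ n, (A l).IsFixedPrecision δ M
  | 0, A => by simp [ofFn, IsFixedPrecision]
  | n + 1, A => by
    rw [ofFn, IsFixedPrecision, isFixedPrecision_ofFn]
    refine ⟨fun h l hl => ?_, fun h => ⟨h 0 (by omega), fun l hl => h _ (by omega)⟩⟩
    rcases l with _ | l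
    exacts [h.1, h.2 l (by omega)]

theorem numNonzero_ofFn {D : ℕ} : ∀ (n : ℕ) (A : ℕ → AffineLayer D D),
    (ofFn n A).numNonzero = ∑ l ∈ Finset.range (n + 1), (A l).numNonzero
  | 0, A => by simp [ofFn, numNonzero]
  | n + 1, A => by
    rw [ofFn, numNonzero, numNonzero_ofFn n, Finset.sum_range_succ' _ (n + 1), add_comm]

theorem ofFn_congr {D : ℕ} : ∀ {n : ℕ} {A B : ℕ → AffineLayer D D}, (∀ l ≤ n, A l = B l) →
    ofFn n A = ofFn n B
  | 0, _, _, h => by rw [ofFn, ofFn, h 0 le_rfl]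
  | n + 1, _, _, h => by
    rw [ofFn, ofFn, h 0 (by omega), ofFn_congr fun l hl => h (l + 1) (by omega)]

/-- The number of hidden layers. -/
def depth : {m n : ℕ} → FeedforwardNet m n → ℕ
  | _, _, last _ => 0
  | _, _, cons _ f => f.depth + 1

end FeedforwardNet

theorem AffineLayer.eval_eq_zero {m n : ℕ} {A : AffineLayer m n} (h : A.numNonzero = 0)
    (x : Fin m → ℝ) : A.eval x = 0 := by
  obtain ⟨h1, h2⟩ := Nat.add_eq_zero_iff.1 h
  rw [Finset.card_eq_zero, Finset.filter_eq_empty_iff] at h1 h2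
  have e1 : A.weight = 0 := by
    ext i j
    simpa using h1 (Finset.mem_univ (i, j))
  have e2 : A.bias = 0 := by
    ext i
    simpa using h2 (Finset.mem_univ i)
  simp [AffineLayer.eval, e1, e2]

/-- A network with more layers than non-zero parameters is constant. -/
theorem FeedforwardNet.eval_const {m n : ℕ} (f : FeedforwardNet m n) (h : f.numNonzero ≤ f.depth) :
    ∃ c, ∀ x, f.eval x = c := by
  induction f with
  | last A => exact ⟨0, fun x => AffineLayer.eval_eq_zero (Nat.le_zero.1 h) x⟩
  | cons A f ih =>
    rw [numNonzero, depth] at h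
    by_cases hf : f.numNonzero ≤ f.depth
    · obtain ⟨c, hc⟩ := ih hf
      exact ⟨c, fun x => hc _⟩
    · exact ⟨f.eval fun _ => max 0 0, fun x => by
        rw [eval, AffineLayer.eval_eq_zero (by omega)]; rfl⟩

/-- With a constant block, all states from time `1` on coincide, so the network halts at the first
iteration, with empty output, or never. -/
theorem LoopedNet.depth_lt_of_outputs {N : LoopedNet} {s : List Bool} (h : N.Outputs s)
    (hs : s ≠ []) : N.block.depth < N.block.numNonzero := by
  by_contra! hd
  obtain ⟨c, hc⟩ := N.block.eval_const hd
  have hst : ∀ t, N.state (t + 1) = c := fun t => by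
    rw [LoopedNet.state, Function.iterate_succ_apply', hc]
  obtain ⟨τ, h1, h2, rfl⟩ := h
  rcases τ with _ | τ
  · exact hs rfl
  · refine h2 1 le_rfl (by omega) ?_
    rw [halt, hst] at h1 ⊢
    exact h1

section Relabel

variable {D a b : ℕ}

/-- A partial labelling of `Fin D` by distinct elements of `Fin a`. -/
def IsLabelling (σ : Fin D → Option (Fin a)) : Prop :=
  ∀ ⦃d d' i⦄, σ d = some i → σ d' = some i → d = d'

/-- A vector in the coordinates given by a labelling. -/
def relabelVec (σ : Fin D → Option (Fin a)) (x : Fin a → ℝ) (d : Fin D) : ℝ := (σ d).elim 0 x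

/-- The labels contain the support of a vector. -/
def CoversSupport (σ : Fin D → Option (Fin a)) (x : Fin a → ℝ) : Prop :=
  ∀ i, x i ≠ 0 → ∃ d, σ d = some i

/-- An affine layer in the coordinates given by labellings. -/
def AffineLayer.relabel (A : AffineLayer a b) (σ : Fin D → Option (Fin a))
    (τ : Fin D → Option (Fin b)) : AffineLayer D D where
  weight d' d := (τ d').elim 0 fun i' => (σ d).elim 0 fun i => A.weight i' i
  bias d' := (τ d').elim 0 A.bias

/-- Labels are not repeated, and every coordinate without a label contributes `0`. -/
theorem sum_relabelVec {σ : Fin D → Option (Fin a)} (hσ : IsLabelling σ) {x : Fin a → ℝ}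
    (hx : CoversSupport σ x) : ∑ d, relabelVec σ x d = ∑ i, x i := by
  have h1 : ∀ i, x i = ∑ d, if σ d = some i then x i else 0 := by
    intro i
    by_cases h0 : x i = 0
    · simp [h0]
    · obtain ⟨d, hd⟩ := hx i h0
      rw [Finset.sum_eq_single d]
      · rw [if_pos hd]
      · exact fun d' _ hne => if_neg fun h => hne (hσ h hd)
      · simp
  rw [Finset.sum_congr rfl fun i _ => h1 i, Finset.sum_comm]
  refine Finset.sum_congr rfl fun d _ => ?_
  cases h : σ d <;> simp [relabelVec, h]

theorem AffineLayer.eval_relabel (A : AffineLayer a b) {σ : Fin D → Option (Fin a)}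
    (hσ : IsLabelling σ) (τ : Fin D → Option (Fin b)) {x : Fin a → ℝ} (hx : CoversSupport σ x) :
    (A.relabel σ τ).eval (relabelVec σ x) = relabelVec τ (A.eval x) := by
  ext d'
  have : (A.relabel σ τ).eval (relabelVec σ x) d' =
    ∑ d, (A.relabel σ τ).weight d' d * relabelVec σ x d + (A.relabel σ τ).bias d' := rfl
  rw [this, relabelVec]
  cases h : τ d' with
  | none => simp [relabel, h]
  | some i' =>
    have : A.eval x i' = ∑ i, A.weight i' i * x i + A.bias i' := rfl
    rw [Option.elim_some, this, ← sum_relabelVec hσ (x := fun i => A.weight i' i * x i)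
      fun i hi => hx i (right_ne_zero_of_mul hi)]
    simp only [relabel, h, Option.elim_some, add_left_inj]
    refine Finset.sum_congr rfl fun d _ => ?_
    cases hd : σ d <;> simp [relabelVec, hd]

/-- A non-zero entry of the relabelled layer sits at labelled positions, and distinct positions
carry distinct labels. -/
theorem AffineLayer.numNonzero_relabel_le (A : AffineLayer a b) {σ : Fin D → Option (Fin a)}
    (hσ : IsLabelling σ) {τ : Fin D → Option (Fin b)} (hτ : IsLabelling τ) :
    (A.relabel σ τ).numNonzero ≤ A.numNonzero := by
  refine Nat.add_le_add
    (Finset.card_le_card_of_forall_subsingleton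
      (fun p q => τ p.1 = some q.1 ∧ σ p.2 = some q.2) ?_ ?_)
    (Finset.card_le_card_of_forall_subsingleton (fun p q => τ p = some q) ?_ ?_)
  · rintro ⟨d', d⟩ h
    replace h := (Finset.mem_filter.1 h).2
    cases h1 : τ d' <;> cases h2 : σ d <;> simp [relabel, h1, h2] at h ⊢
    exact h
  · rintro ⟨i', i⟩ - ⟨d', d⟩ h ⟨e', e⟩ h'
    exact Prod.ext (hτ h.2.1 h'.2.1) (hσ h.2.2 h'.2.2)
  · rintro d' h
    replace h := (Finset.mem_filter.1 h).2
    cases h1 : τ d' <;> simp [relabel, h1] at h ⊢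
    exact h
  · rintro i - d h e h'
    exact hτ h.2 h'.2

theorem AffineLayer.IsFixedPrecision.relabel {δ M : ℝ} {A : AffineLayer a b}
    (hA : A.IsFixedPrecision δ M) (hM : 0 ≤ M) (σ : Fin D → Option (Fin a))
    (τ : Fin D → Option (Fin b)) : (A.relabel σ τ).IsFixedPrecision δ M := by
  have h0 : (0 : ℝ) ∈ fixedPrecisionValues δ M := ⟨⟨0, by simp⟩, by simpa using hM⟩
  refine ⟨fun d' d => ?_, fun d' => ?_⟩
  · cases h1 : τ d' <;> cases h2 : σ d <;> simp only [AffineLayer.relabel, h1, h2] <;>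
      first | exact h0 | exact hA.1 _ _
  · cases h1 : τ d' <;> simp only [AffineLayer.relabel, h1]
    exacts [h0, hA.2 _]

theorem exists_isLabelling (S : Finset (Fin a)) (h : S.card ≤ D) :
    ∃ σ : Fin D → Option (Fin a), IsLabelling σ ∧ (∀ i ∈ S, ∃ d, σ d = some i) ∧
      ∀ d i, σ d = some i → i ∈ S := by
  refine ⟨fun d => if hd : (d : ℕ) < S.card then some (S.equivFin.symm ⟨d, hd⟩) else none,
    ?_, ?_, ?_⟩
  · intro d d' i h1 h2
    simp only [Option.dite_none_right_eq_some, Option.some.injEq] at h1 h2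
    obtain ⟨h1, rfl⟩ := h1
    obtain ⟨h2, h3⟩ := h2
    have := S.equivFin.symm.injective (Subtype.ext h3)
    ext
    exact (congrArg Fin.val this).symm
  · intro i hi
    refine ⟨⟨S.equivFin ⟨i, hi⟩, (Fin.is_lt _).trans_le h⟩, ?_⟩
    simp
  · intro d i h1
    simp only [Option.dite_none_right_eq_some, Option.some.injEq] at h1
    obtain ⟨h1, rfl⟩ := h1
    exact Subtype.prop _

/-- The coordinates that a layer does not map identically to `0`. -/
noncomputable def AffineLayer.active (A : AffineLayer a b) : Finset (Fin b) :=
  (Finset.univ.filter fun ij : Fin b × Fin a => A.weight ij.1 ij.2 ≠ 0).image Prod.fst ∪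
    Finset.univ.filter fun i : Fin b => A.bias i ≠ 0

theorem AffineLayer.card_active_le (A : AffineLayer a b) : A.active.card ≤ A.numNonzero :=
  (Finset.card_union_le _ _).trans (Nat.add_le_add_right Finset.card_image_le _)

theorem AffineLayer.mem_active (A : AffineLayer a b) {x : Fin a → ℝ} {i : Fin b}
    (h : A.eval x i ≠ 0) : i ∈ A.active := by
  contrapose! h
  simp only [active, Finset.mem_union, Finset.mem_image, Finset.mem_filter, Finset.mem_univ,
    true_and, Prod.exists, exists_and_right, exists_eq_right, not_or, not_exists, not_not] at h
  have : A.eval x i = ∑ j, A.weight i j * x j + A.bias i := rfl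
  simp [this, h.1, h.2]

/-- The active coordinates of the last layer. -/
noncomputable def FeedforwardNet.active : {m n : ℕ} → FeedforwardNet m n → Finset (Fin n)
  | _, _, last A => A.active
  | _, _, cons _ f => f.active

theorem FeedforwardNet.card_active_le (f : FeedforwardNet a b) : f.active.card ≤ f.numNonzero := by
  induction f with
  | last A => exact A.card_active_le
  | cons A f ih => exact ih.trans (Nat.le_add_left _ _)

theorem FeedforwardNet.mem_active (f : FeedforwardNet a b) {x : Fin a → ℝ} {i : Fin b}
    (h : f.eval x i ≠ 0) : i ∈ f.active := by
  induction f with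
  | last A => exact A.mem_active h
  | cons A f ih => exact ih h

/-- A network with few non-zero parameters is equivalent to a network of small constant width. -/
theorem FeedforwardNet.exists_ofFn {δ M : ℝ} (hM : 0 ≤ M) (f : FeedforwardNet a b)
    (hf : f.IsFixedPrecision δ M) (hD : f.numNonzero ≤ D) {σ : Fin D → Option (Fin a)}
    (hσ : IsLabelling σ) {τ : Fin D → Option (Fin b)} (hτ : IsLabelling τ) :
    ∃ A : ℕ → AffineLayer D D, (ofFn f.depth A).IsFixedPrecision δ M ∧
      (ofFn f.depth A).numNonzero ≤ f.numNonzero ∧ ∀ x, CoversSupport σ x →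
        (ofFn f.depth A).eval (relabelVec σ x) = relabelVec τ (f.eval x) := by
  induction f with
  | last A =>
    exact ⟨fun _ => A.relabel σ τ, AffineLayer.IsFixedPrecision.relabel hf hM _ _,
      A.numNonzero_relabel_le hσ hτ, fun x hx => A.eval_relabel hσ τ hx⟩
  | cons A f ih =>
    rw [numNonzero] at hD
    -- Only the active neurons of the hidden layer get a place; there are at most as many as
    -- non-zero parameters, so they fit in the width `D`. An inactive neuron is `0` before and after
    -- ReLU, and so is an unused place.
    obtain ⟨ρ, hρ, hcov, -⟩ := exists_isLabelling (D := D) A.active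
      (A.card_active_le.trans (by omega))
    obtain ⟨B, h1, h2, h3⟩ := ih hf.2 (by omega) hρ hτ
    have hcons : ofFn (cons A f).depth (fun l => Nat.casesOn l (A.relabel σ ρ) B) =
      cons (A.relabel σ ρ) (ofFn f.depth B) := rfl
    refine ⟨fun l => Nat.casesOn l (A.relabel σ ρ) B, hcons ▸ ⟨hf.1.relabel hM _ _, h1⟩,
      hcons ▸ Nat.add_le_add (A.numNonzero_relabel_le hσ hρ) h2, fun x hx => ?_⟩
    rw [hcons, eval, eval, ← h3]
    · rw [A.eval_relabel hσ ρ hx]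
      congr 1
      ext d
      cases h : ρ d <;> simp [relabelVec, h]
    · intro i hi
      refine hcov i (A.mem_active (x := x) fun h => hi ?_)
      simp only [h, max_self]

/-- The same labelling serves at both ends of the block, so that relabelling commutes with
iteration. It fixes the three channels, whence the `+ 3`, and otherwise lists the active coordinates
of the last layer; all states are supported there, because `x_0 = 0` and later states are outputs of
the block. -/
theorem LoopedNet.exists_ofFn {δ M : ℝ} (hM : 0 ≤ M) (N : LoopedNet)
    (hN : N.block.IsFixedPrecision δ M) {m : ℕ} (hm : N.block.numNonzero ≤ m) :
    ∃ A : ℕ → AffineLayer (m + 3) (m + 3),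
      (FeedforwardNet.ofFn N.block.depth A).IsFixedPrecision δ M ∧
      (FeedforwardNet.ofFn N.block.depth A).numNonzero ≤ N.block.numNonzero ∧
      ∀ s, N.Outputs s →
        LoopedNet.Outputs ⟨m + 3, by omega, FeedforwardNet.ofFn N.block.depth A⟩ s := by
  obtain ⟨ρ, hρ, hcov, hmem⟩ := exists_isLabelling (D := m)
    (N.block.active.filter fun i => 3 ≤ (i : ℕ))
    ((Finset.card_filter_le _ _).trans (N.block.card_active_le.trans hm))
  let σ : Fin (m + 3) → Option (Fin N.n) := fun d =>
    if h : (d : ℕ) < 3 then some ⟨d, h.trans_le N.three_le⟩ else ρ ⟨d - 3, by omega⟩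
  have hσ3 : ∀ c (hc : c < 3), σ ⟨c, by omega⟩ = some ⟨c, hc.trans_le N.three_le⟩ :=
    fun c hc => dif_pos hc
  have hσ : IsLabelling σ := by
    intro d d' i h1 h2
    simp only [σ] at h1 h2
    split_ifs at h1 h2 with h3 h4 h4
    · rw [← h1] at h2
      simp only [Option.some.injEq, Fin.mk.injEq] at h2
      exact Fin.ext h2.symm
    · have := hmem _ _ h2
      rw [← Option.some.inj h1] at this
      simp at this
      omega
    · have := hmem _ _ h1
      rw [← Option.some.inj h2] at this
      simp at this
      omega
    · have := hρ h1 h2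
      simp only [Fin.mk.injEq] at this
      ext
      omega
  obtain ⟨A, h1, h2, h3⟩ := N.block.exists_ofFn (D := m + 3) hM hN (by omega) hσ hσ
  refine ⟨A, h1, h2, fun s hs => ?_⟩
  set N' : LoopedNet := ⟨m + 3, by omega, FeedforwardNet.ofFn N.block.depth A⟩ with hN'
  have hcovers : ∀ t, CoversSupport σ (N.state t) := by
    intro t i hi
    rcases t with _ | t
    · exact absurd rfl hi
    · rw [LoopedNet.state, Function.iterate_succ_apply'] at hi
      by_cases h : (i : ℕ) < 3
      · exact ⟨_, hσ3 i h⟩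
      · obtain ⟨d, hd⟩ := hcov i (by simpa using ⟨N.block.mem_active hi, by omega⟩)
        refine ⟨⟨d + 3, by omega⟩, ?_⟩
        simp [σ, hd]
  have hst : ∀ t, N'.state t = relabelVec σ (N.state t) := by
    intro t
    induction t with
    | zero =>
      ext d
      change (0 : ℝ) = relabelVec σ 0 d
      cases h : σ d <;> simp [relabelVec, h]
    | succ t ih =>
      have e1 : N'.state (t + 1) = N'.block.eval (N'.state t) := Function.iterate_succ_apply' _ _ _
      have e2 : N.state (t + 1) = N.block.eval (N.state t) := Function.iterate_succ_apply' _ _ _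
      rw [e1, e2, ← h3 _ (hcovers t), ← ih]
  have hch : ∀ t c (hc : c < 3), N'.state t ⟨c, hc.trans_le N'.three_le⟩ =
      N.state t ⟨c, hc.trans_le N.three_le⟩ := by
    intro t c hc
    rw [hst, relabelVec]
    exact congrArg (fun o => Option.elim o 0 (N.state t)) (hσ3 c hc)
  exact hs.of_eq (fun t => hch t 0 (by omega)) (fun t => hch t 1 (by omega))
    fun t => hch t 2 (by omega)

end Relabel

/-! ### Unboundedness and non-computability of the complexity -/

theorem neuralComplexity_le_iff {δ M : ℝ} {s : List Bool} {m : ℕ} :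
    neuralComplexity δ M s ≤ m ↔ ∃ N : LoopedNet, N.block.IsFixedPrecision δ M ∧ N.Outputs s ∧
      N.block.numNonzero ≤ m := by
  constructor
  swap
  · rintro ⟨N, h1, h2, h3⟩
    have : neuralComplexity δ M s ≤ (N.block.numNonzero : ℕ∞) := sInf_le ⟨N, h1, h2, rfl⟩
    exact this.trans (by exact_mod_cast h3)
  intro h
  have hlt : neuralComplexity δ M s < ((m + 1 : ℕ) : ℕ∞) :=
    h.trans_lt (by exact_mod_cast m.lt_succ_self)
  obtain ⟨_, ⟨N, h1, h2, rfl⟩, h3⟩ := sInf_lt_iff.1 hlt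
  exact ⟨N, h1, h2, Nat.lt_succ_iff.1 (by exact_mod_cast h3)⟩

/-- Parameters become letters of a finite alphabet that depends on `δ` and `M` only through `⌊M /
δ⌋₊`. An algorithm can have this number built in, so `M` need not be computable. -/
theorem mem_fixedPrecisionValues_iff {δ M : ℝ} (hδ : 0 < δ) (hM : δ ≤ M) {v : ℝ} :
    v ∈ fixedPrecisionValues δ M ↔
      ∃ w : Fin (2 * ⌊M / δ⌋₊ + 1), v = δ * (((w : ℕ) : ℤ) - (⌊M / δ⌋₊ : ℤ) : ℤ) := by
  have key : ∀ k : ℤ, δ * k ∈ Set.Icc (-M) M ↔ |k| ≤ (⌊M / δ⌋₊ : ℤ) := by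
    intro k
    rw [Set.mem_Icc, ← abs_le, abs_mul, abs_of_pos hδ, ← le_div_iff₀' hδ,
      Int.abs_eq_natAbs, Nat.cast_le, Nat.le_floor_iff (div_nonneg (hδ.le.trans hM) hδ.le),
      Nat.cast_natAbs, Int.cast_abs]
  constructor
  · rintro ⟨⟨k, rfl⟩, h⟩
    have := abs_le.1 ((key k).1 h)
    refine ⟨⟨(k + ⌊M / δ⌋₊).toNat, by omega⟩, ?_⟩
    congr 2
    dsimp only
    omega
  · rintro ⟨w, rfl⟩
    exact ⟨⟨_, rfl⟩, (key _).2 (abs_le.2 (by omega))⟩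

theorem finite_isFixedPrecision {δ M : ℝ} (hδ : 0 < δ) (hM : δ ≤ M) (a b : ℕ) :
    Finite {A : AffineLayer a b // A.IsFixedPrecision δ M} := by
  have : Finite (fixedPrecisionValues δ M) := by
    refine ((Set.finite_range fun w : Fin (2 * ⌊M / δ⌋₊ + 1) =>
      δ * (((w : ℕ) : ℤ) - (⌊M / δ⌋₊ : ℤ) : ℤ)).subset fun v hv => ?_).to_subtype
    obtain ⟨w, rfl⟩ := (mem_fixedPrecisionValues_iff hδ hM).1 hv
    exact ⟨w, rfl⟩
  refine Finite.of_injective (β := (Fin b → Fin a → fixedPrecisionValues δ M) ×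
    (Fin b → fixedPrecisionValues δ M))
    (fun A => (fun i j => ⟨_, A.2.1 i j⟩, fun i => ⟨_, A.2.2 i⟩)) ?_
  rintro ⟨⟨W, v⟩, hA⟩ ⟨⟨W', v'⟩, hA'⟩ h
  simp only [Prod.mk.injEq, funext_iff, Subtype.mk.injEq] at h
  congr
  exacts [Matrix.ext h.1, funext h.2]

/-- The complexity is unbounded. -/
theorem exists_lt_neuralComplexity {δ M : ℝ} (hδ : 0 < δ) (hM : δ ≤ M) (m : ℕ) :
    ∃ s, (m : ℕ∞) < neuralComplexity δ M s := by
  by_contra! hall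
  let L := {A : AffineLayer (m + 3) (m + 3) // A.IsFixedPrecision δ M}
  have hL : Finite L := finite_isFixedPrecision hδ hM _ _
  -- The empty string is excluded since it gives no bound on the depth. The layers used have index
  -- at most `d < m`, so reduction modulo `m + 1` does not affect them.
  have key : ∀ s : {s : List Bool // s ≠ []}, ∃ d : Fin m, ∃ A : Fin (m + 1) → L,
      LoopedNet.Outputs ⟨m + 3, by omega, FeedforwardNet.ofFn d
        fun l => (A (Fin.ofNat (m + 1) l)).1⟩ s := by
    rintro ⟨s, hs⟩
    obtain ⟨N, h1, h2, h3⟩ := neuralComplexity_le_iff.1 (hall s)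
    obtain ⟨A, hA, -, hout⟩ := N.exists_ofFn (hδ.le.trans hM) h1 h3
    have hd := N.depth_lt_of_outputs h2 hs
    rw [FeedforwardNet.isFixedPrecision_ofFn] at hA
    refine ⟨⟨N.block.depth, by omega⟩, fun l => if h : (l : ℕ) ≤ N.block.depth then ⟨A l, hA l h⟩
      else ⟨A 0, hA 0 (by omega)⟩, ?_⟩
    convert hout s h2 using 2
    refine FeedforwardNet.ofFn_congr fun l hl => ?_
    dsimp only at hl
    have : ((Fin.ofNat (m + 1) l : Fin (m + 1)) : ℕ) = l := Nat.mod_eq_of_lt (by omega)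
    simp only [this]
    rw [dif_pos hl]
  choose d A h using key
  have : Finite {s : List Bool // s ≠ []} := by
    refine Finite.of_injective (fun s => (d s, A s)) fun s s' hss => ?_
    simp only [Prod.mk.injEq] at hss
    have h1 := h s
    rw [hss.1, hss.2] at h1
    exact Subtype.ext (h1.unique (h s'))
  have h' : Infinite {s : List Bool // s ≠ []} :=
    Infinite.of_injective (fun n : ℕ => ⟨List.replicate (n + 1) true, by simp⟩) fun a b hab => by
      simpa using congrArg (fun s => s.1.length) hab
  exact not_finite {s : List Bool // s ≠ []}

/-- Berry's paradox. The threshold is cubic because the simulating networks are counted by all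
entries of their matrices, which is quadratic in the number of instructions. -/
theorem not_isComputableENat_neuralComplexity {δ M : ℝ} (hδ : 0 < δ) (hM : δ ≤ M) :
    ¬ IsComputableENat (neuralComplexity δ M) := by
  rintro ⟨φ, hφ, hext⟩
  obtain ⟨str, hstr, hsurj⟩ : ∃ str : ℕ → List Bool, Computable str ∧ Function.Surjective str :=
    ⟨fun j => (Encodable.decode j).getD [], Computable.option_getD Computable.decode (.const []),
      fun s => ⟨Encodable.encode s, by simp⟩⟩
  obtain ⟨test, htest, hspec⟩ : ∃ test : ℕ → ℕ → Bool, Computable₂ test ∧ ∀ p j,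
      test p j = true ↔ ((p * p * p : ℕ) : ℕ∞) < neuralComplexity δ M (str j) := by
    -- The value `none` stands for `∞`, which exceeds every threshold.
    refine ⟨fun p j => Option.casesOn (φ (str j)) true fun c => decide (p * p * p < c), ?_, ?_⟩
    · refine Computable.option_casesOn (hφ.comp (hstr.comp .snd)) (.const true) ?_
      have hp : Computable fun x : (ℕ × ℕ) × ℕ => x.1.1 := Computable.fst.comp .fst
      exact (PrimrecRel.decide Primrec.nat_lt).to_comp.comp
        (Primrec.nat_mul.to_comp.comp (Primrec.nat_mul.to_comp.comp hp hp) hp) .snd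
    · intro p j
      rw [← hext]
      cases h : φ (str j) with
      | none => simp only [h, extNat, true_iff]; exact ENat.natCast_lt_top _
      | some c => simp only [h, extNat, decide_eq_true_eq, Nat.cast_lt]
  have hex : ∀ p, ∃ j, test p j = true := by
    intro p
    obtain ⟨s, hs⟩ := exists_lt_neuralComplexity hδ hM (p * p * p)
    obtain ⟨j, rfl⟩ := hsurj s
    exact ⟨j, (hspec _ _).2 hs⟩
  let S : ℕ → List Bool := fun p => str (Nat.find (hex p))
  have hS : Computable S := hstr.comp (Computable.find (P := fun p j => test p j = true)
    (ComputablePred.computable_iff.2 ⟨_, htest, rfl⟩) hex)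
  have hSN : ∀ p, ((p * p * p : ℕ) : ℕ∞) < neuralComplexity δ M (S p) := fun p =>
    (hspec _ _).1 (Nat.find_spec (hex p))
  obtain ⟨m, c, hC⟩ := RegInstr.exists_steps_of_computable hS
  -- The number of copies depends on `δ` alone, not on `p`.
  obtain ⟨k, hk⟩ := exists_nat_ge (1 / δ ^ 2)
  rw [div_le_iff₀ (by positivity)] at hk
  have hbound : ∀ p, p * p * p < 2 * ((2 * (p + c) + m + 4) * k + 1) * (p + c + m + 6) := by
    intro p
    obtain ⟨C, hlen, hm, σ, hσ⟩ := hC p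
    obtain ⟨N, h1, h2, h3⟩ := RegInstr.exists_net_outputs C m hδ hM k hk hm hσ
    have := (hSN p).trans_le (neuralComplexity_le_iff.2 ⟨N, h1, h2, le_rfl⟩)
    rw [hlen] at h3
    exact (by exact_mod_cast this : p * p * p < N.block.numNonzero).trans_le h3
  set q := c + m + 6
  -- For `p ≥ q` the quadratic bound is at most `16 * (k + 1) * p ^ 2`, and `p` is chosen to be at
  -- least `16 * (k + 1)` as well.
  set p := q * (16 * (k + 1)) with hp
  refine (hbound p).not_ge ?_
  have hqp : q ≤ p := Nat.le_mul_of_pos_right _ (by omega)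
  calc 2 * ((2 * (p + c) + m + 4) * k + 1) * (p + c + m + 6)
      ≤ 2 * (4 * p * k + 4 * p) * (2 * p) := by gcongr <;> omega
    _ = 1 * (16 * (k + 1)) * p * p := by ring
    _ ≤ q * (16 * (k + 1)) * p * p := by gcongr; omega
    _ = p * p * p := rfl

/-! ### Primitive recursive arithmetic of integers and integer polynomials -/

section IntPrimrec

theorem encode_natCast (n : ℕ) : Encodable.encode (n : ℤ) = 2 * n := rfl

theorem encode_negSucc (n : ℕ) : Encodable.encode (Int.negSucc n) = 2 * n + 1 := rfl

/-- Parity of the code gives the sign of an integer. Addition and multiplication are then reduced to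
natural numbers through `z = z.toNat - (-z).toNat`. -/
theorem primrec_toNat : Primrec Int.toNat := by
  have : Primrec fun z : ℤ => bif (Encodable.encode z).bodd then 0 else (Encodable.encode z).div2 :=
    Primrec.cond (Primrec.nat_bodd.comp .encode) (.const 0) (Primrec.nat_div2.comp .encode)
  refine this.of_eq fun z => ?_
  cases z with
  | ofNat n => simp [encode_natCast]
  | negSucc n => simp [encode_negSucc]

theorem primrec_neg_toNat : Primrec fun z : ℤ => (-z).toNat := by
  have : Primrec fun z : ℤ =>
      bif (Encodable.encode z).bodd then (Encodable.encode z).div2 + 1 else 0 :=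
    Primrec.cond (Primrec.nat_bodd.comp .encode)
      (Primrec.succ.comp (Primrec.nat_div2.comp .encode)) (.const 0)
  refine this.of_eq fun z => ?_
  cases z with
  | ofNat n => simp [encode_natCast]
  | negSucc n => simp [encode_negSucc, Int.neg_negSucc]

theorem primrec_natCast_sub : Primrec₂ fun a b : ℕ => (a : ℤ) - b := by
  refine Primrec.encode_iff.1 ?_
  have : Primrec fun x : ℕ × ℕ =>
      if x.2 ≤ x.1 then 2 * (x.1 - x.2) else 2 * (x.2 - x.1 - 1) + 1 :=
    Primrec.ite (Primrec.nat_le.comp .snd .fst)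
      (Primrec.nat_mul.comp (.const 2) (Primrec.nat_sub.comp .fst .snd))
      (Primrec.succ.comp (Primrec.nat_mul.comp (.const 2) (Primrec.nat_sub.comp
        (Primrec.nat_sub.comp .snd .fst) (.const 1))))
  refine this.of_eq fun ⟨a, b⟩ => ?_
  dsimp only
  split_ifs with h
  · rw [← Nat.cast_sub h, encode_natCast]
  · have : (a : ℤ) - b = Int.negSucc (b - a - 1) := by omega
    rw [this, encode_negSucc]

theorem primrec_intAdd : Primrec₂ fun a b : ℤ => a + b := by
  have h1 : Primrec fun x : ℤ × ℤ => x.1.toNat := primrec_toNat.comp .fst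
  have h2 : Primrec fun x : ℤ × ℤ => x.2.toNat := primrec_toNat.comp .snd
  have h3 : Primrec fun x : ℤ × ℤ => (-x.1).toNat := primrec_neg_toNat.comp .fst
  have h4 : Primrec fun x : ℤ × ℤ => (-x.2).toNat := primrec_neg_toNat.comp .snd
  refine (primrec_natCast_sub.comp (Primrec.nat_add.comp h1 h2)
    (Primrec.nat_add.comp h3 h4)).of_eq fun x => ?_
  dsimp only
  omega

theorem primrec_intMul : Primrec₂ fun a b : ℤ => a * b := by
  have h1 : Primrec fun x : ℤ × ℤ => x.1.toNat := primrec_toNat.comp .fst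
  have h2 : Primrec fun x : ℤ × ℤ => x.2.toNat := primrec_toNat.comp .snd
  have h3 : Primrec fun x : ℤ × ℤ => (-x.1).toNat := primrec_neg_toNat.comp .fst
  have h4 : Primrec fun x : ℤ × ℤ => (-x.2).toNat := primrec_neg_toNat.comp .snd
  refine (primrec_natCast_sub.comp
    (Primrec.nat_add.comp (Primrec.nat_mul.comp h1 h2) (Primrec.nat_mul.comp h3 h4))
    (Primrec.nat_add.comp (Primrec.nat_mul.comp h1 h4) (Primrec.nat_mul.comp h3 h2))).of_eq
      fun x => ?_
  have e : ∀ z : ℤ, (z.toNat : ℤ) - ((-z).toNat : ℤ) = z := fun z => by omega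
  conv_rhs => rw [← e x.1, ← e x.2]
  push_cast
  ring

end IntPrimrec

section CoeffList

open Polynomial

/-- The polynomial with a given list of coefficients. -/
noncomputable def listPoly (p : List ℤ) : ℤ[X] := p.foldr (fun c f => C c + X * f) 0

theorem listPoly_cons (c : ℤ) (p : List ℤ) : listPoly (c :: p) = C c + X * listPoly p := rfl

theorem coeff_listPoly : ∀ (p : List ℤ) (i : ℕ), (listPoly p).coeff i = p.getD i 0
  | [], i => by simp [listPoly]
  | c :: p, 0 => by simp [listPoly_cons]
  | c :: p, i + 1 => by
    rw [listPoly_cons, coeff_add, coeff_X_mul, coeff_listPoly p, coeff_C_succ, zero_add,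
      List.getD_cons_succ]

theorem listPoly_surjective : Function.Surjective listPoly := by
  intro f
  refine ⟨(List.range (f.natDegree + 1)).map f.coeff, ?_⟩
  ext i
  rw [coeff_listPoly, List.getD_eq_getElem?_getD, List.getElem?_map]
  by_cases h : i < f.natDegree + 1
  · simp [List.getElem?_range h]
  · rw [List.getElem?_eq_none (by simpa using h), coeff_eq_zero_of_natDegree_lt (by omega)]
    rfl

/-- Addition of polynomials given by their coefficients. -/
def listAdd (p q : List ℤ) : List ℤ :=
  (List.range (p.length + q.length)).map fun i => p.getD i 0 + q.getD i 0

theorem listPoly_listAdd (p q : List ℤ) : listPoly (listAdd p q) = listPoly p + listPoly q := by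
  ext i
  rw [coeff_add, coeff_listPoly, coeff_listPoly, coeff_listPoly, listAdd,
    List.getD_eq_getElem?_getD, List.getElem?_map]
  by_cases h : i < p.length + q.length
  · simp [List.getElem?_range h]
  · rw [List.getElem?_eq_none (by simpa using h), List.getD_eq_default _ _ (by omega),
      List.getD_eq_default _ _ (by omega)]
    rfl

theorem primrec_listAdd : Primrec₂ listAdd := by
  refine Primrec.list_map (Primrec.list_range.comp (Primrec.nat_add.comp
    (Primrec.list_length.comp .fst) (Primrec.list_length.comp .snd))) ?_
  exact primrec_intAdd.comp
    ((Primrec.list_getD 0).comp (Primrec.fst.comp .fst) .snd)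
    ((Primrec.list_getD 0).comp (Primrec.snd.comp .fst) .snd)

/-- Scalar multiplication of a polynomial given by its coefficients. -/
def listSmul (c : ℤ) (p : List ℤ) : List ℤ := p.map fun x => c * x

theorem listPoly_listSmul (c : ℤ) (p : List ℤ) : listPoly (listSmul c p) = C c * listPoly p := by
  induction p with
  | nil => simp [listSmul, listPoly]
  | cons a p ih =>
    rw [listSmul, List.map_cons, listPoly_cons, ← listSmul, ih, listPoly_cons, C_mul]
    ring

theorem primrec_listSmul : Primrec₂ listSmul :=
  Primrec.list_map .snd (primrec_intMul.comp (Primrec.fst.comp .fst) .snd)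

/-- Multiplication of polynomials given by their coefficients. -/
def listMul (p q : List ℤ) : List ℤ :=
  p.foldr (fun c f => listAdd (listSmul c q) (0 :: f)) []

theorem listPoly_listMul (p q : List ℤ) : listPoly (listMul p q) = listPoly p * listPoly q := by
  induction p with
  | nil => simp [listMul, listPoly]
  | cons a p ih =>
    rw [listMul, List.foldr_cons, ← listMul, listPoly_listAdd, listPoly_listSmul, listPoly_cons, ih,
      listPoly_cons, C_0]
    ring

theorem primrec_listMul : Primrec₂ listMul := by
  refine Primrec.list_foldr (α := List ℤ × List ℤ)
    (h := fun x s => listAdd (listSmul s.1 x.2) (0 :: s.2)) Primrec.fst (.const []) ?_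
  exact primrec_listAdd.comp
    (primrec_listSmul.comp (Primrec.fst.comp .snd) (Primrec.snd.comp .fst))
    (Primrec.list_cons.comp (.const 0) (Primrec.snd.comp .snd))

/-- The test whether a polynomial given by its coefficients is `0`. -/
def listIsZero (p : List ℤ) : Bool := p.foldr (fun c b => decide (c = 0) && b) true

/-- Lists may end in zeros, so a polynomial does not determine its list; identities are therefore
tested by the vanishing of all coefficients of a difference. -/
theorem listIsZero_iff (p : List ℤ) : listIsZero p = true ↔ listPoly p = 0 := by
  induction p with
  | nil => simp [listIsZero, listPoly]
  | cons a p ih =>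
    rw [listIsZero, List.foldr_cons, ← listIsZero, Bool.and_eq_true, decide_eq_true_iff, ih,
      listPoly_cons]
    constructor
    · rintro ⟨rfl, h⟩
      simp [h]
    · intro h
      have h0 : a = 0 := by simpa using congrArg (fun f => f.coeff 0) h
      simpa [h0] using h

theorem primrec_listIsZero : Primrec listIsZero := by
  refine Primrec.list_foldr (α := List ℤ) (h := fun _ s => decide (s.1 = 0) && s.2) Primrec.id
    (.const true) ?_
  exact Primrec.and.comp ((PrimrecRel.decide Primrec.eq).comp (Primrec.fst.comp .snd) (.const 0))
    (Primrec.snd.comp .snd)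

/-- The integer polynomials that vanish at a point are, up to a constant factor, the multiples of
one of them. -/
theorem exists_aeval_eq_zero_iff (δ : ℝ) : ∃ q : ℤ[X], ∀ p : ℤ[X],
    aeval δ p = 0 ↔ ∃ c : ℤ, c ≠ 0 ∧ ∃ u : ℤ[X], C c * p = u * q := by
  -- The relations of `δ` form a principal ideal over `ℚ`, with `g = 0` if `δ` is transcendental.
  -- Clearing denominators of the generator and of the cofactor accounts for the constant `c`.
  obtain ⟨g, hg⟩ := (inferInstance :
    (RingHom.ker (aeval δ : ℚ[X] →ₐ[ℚ] ℝ)).IsPrincipal).principal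
  have hmem : ∀ f : ℚ[X], aeval δ f = 0 ↔ g ∣ f := by
    intro f
    rw [← RingHom.mem_ker, hg, ← Ideal.mem_span_singleton]
  have hmap : ∀ p : ℤ[X], aeval δ (p.map (algebraMap ℤ ℚ)) = aeval δ p := fun p =>
    aeval_map_algebraMap ℚ δ p
  have hden : ∀ f : ℚ[X], ∃ c : ℤ, c ≠ 0 ∧ ∃ u : ℤ[X],
      u.map (algebraMap ℤ ℚ) = C (c : ℚ) * f := by
    intro f
    obtain ⟨b, hb, hbf⟩ := IsLocalization.integerNormalization_spec (nonZeroDivisors ℤ) f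
    refine ⟨b, nonZeroDivisors.ne_zero hb, _, hbf.trans ?_⟩
    rw [zsmul_eq_mul]
    simp
  obtain ⟨d, hd, q, hq⟩ := hden g
  have hd' : (d : ℚ) ≠ 0 := by exact_mod_cast hd
  refine ⟨q, fun p => ⟨fun hp => ?_, ?_⟩⟩
  · obtain ⟨h, hh⟩ := (hmem _).1 ((hmap p).trans hp)
    obtain ⟨e, he, u, hu⟩ := hden h
    refine ⟨d * e, mul_ne_zero hd he, u, ?_⟩
    apply map_injective (algebraMap ℤ ℚ) (algebraMap ℤ ℚ).injective_int
    rw [Polynomial.map_mul, Polynomial.map_mul, hu, hq, hh]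
    simp
    ring
  · rintro ⟨c, hc, u, hu⟩
    have h1 : aeval δ q = 0 := by
      rw [← hmap, hq, hmem]
      exact dvd_mul_left _ _
    have h2 := congrArg (aeval δ) hu
    rw [map_mul, map_mul, h1, mul_zero, aeval_C] at h2
    exact (mul_eq_zero.1 h2).resolve_left (by simpa using hc)

end CoeffList

/-! ### The sign of an integer polynomial at a computable real -/

section Sign

open Polynomial Filter Topology

/-- Numerator and denominator of the value at `x / N` of the polynomial with coefficients `f c`,
where `c` runs over a list. -/
def fracEval (f : ℤ → ℕ) (x N : ℕ) (p : List ℤ) : ℕ × ℕ :=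
  p.foldr (fun c s => (f c * (s.2 * N) + x * s.1, s.2 * N)) (0, 1)

/-- The value at `x` of the polynomial with coefficients `f c`, where `c` runs over a list. -/
noncomputable def natEval (f : ℤ → ℕ) (x : ℝ) (p : List ℤ) : ℝ :=
  p.foldr (fun c s => f c + x * s) 0

theorem natEval_cons (f : ℤ → ℕ) (x : ℝ) (c : ℤ) (p : List ℤ) :
    natEval f x (c :: p) = f c + x * natEval f x p := rfl

theorem fracEval_cons (f : ℤ → ℕ) (x N : ℕ) (c : ℤ) (p : List ℤ) :
    fracEval f x N (c :: p) = (f c * ((fracEval f x N p).2 * N) + x * (fracEval f x N p).1,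
      (fracEval f x N p).2 * N) := rfl

theorem fracEval_snd (f : ℤ → ℕ) (x N : ℕ) (p : List ℤ) :
    (fracEval f x N p).2 = N ^ p.length := by
  induction p with
  | nil => rfl
  | cons c p ih => rw [fracEval_cons, ih, List.length_cons, pow_succ]

theorem fracEval_fst (f : ℤ → ℕ) (x N : ℕ) (hN : 0 < N) (p : List ℤ) :
    ((fracEval f x N p).1 : ℝ) = natEval f (x / N) p * N ^ p.length := by
  have : (N : ℝ) ≠ 0 := by positivity
  induction p with
  | nil => simp [fracEval, natEval]
  | cons c p ih =>
    rw [fracEval_cons, natEval_cons, fracEval_snd, List.length_cons]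
    push_cast
    rw [ih]
    field_simp
    ring

theorem natEval_nonneg (f : ℤ → ℕ) {x : ℝ} (hx : 0 ≤ x) (p : List ℤ) : 0 ≤ natEval f x p := by
  induction p with
  | nil => exact le_rfl
  | cons c p ih => exact add_nonneg (Nat.cast_nonneg _) (mul_nonneg hx ih)

theorem natEval_mono (f : ℤ → ℕ) {x y : ℝ} (hx : 0 ≤ x) (hxy : x ≤ y) (p : List ℤ) :
    natEval f x p ≤ natEval f y p := by
  induction p with
  | nil => exact le_rfl
  | cons c p ih =>
    exact add_le_add_right (mul_le_mul hxy ih (natEval_nonneg f hx p) (hx.trans hxy)) _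

theorem continuous_natEval (f : ℤ → ℕ) (p : List ℤ) : Continuous fun x => natEval f x p := by
  induction p with
  | nil => exact continuous_const
  | cons c p ih => exact continuous_const.add (continuous_id.mul ih)

theorem aeval_listPoly_eq (x : ℝ) (p : List ℤ) :
    aeval x (listPoly p) = natEval Int.toNat x p - natEval (fun z => (-z).toNat) x p := by
  induction p with
  | nil => simp [listPoly, natEval]
  | cons c p ih =>
    have : (c : ℝ) = (c.toNat : ℝ) - ((-c).toNat : ℝ) := by
      have h : c = (c.toNat : ℤ) - ((-c).toNat : ℤ) := by omega
      exact_mod_cast congrArg (Int.cast (R := ℝ)) h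
    rw [listPoly_cons, natEval_cons, natEval_cons, map_add, map_mul, aeval_X, aeval_C, ih]
    simp only [algebraMap_int_eq, eq_intCast]
    rw [this]
    ring

/-- The test whether a polynomial is positive on an interval around `a n / 2 ^ n`. -/
def posCheck (a : ℕ → ℤ) (n : ℕ) (p : List ℤ) : Bool :=
  decide ((fracEval (fun z => (-z).toNat) ((a n).toNat + 1) (2 ^ n) p).1 <
    (fracEval Int.toNat ((a n).toNat - 1) (2 ^ n) p).1)

/-- Splitting the coefficients by sign writes the polynomial as a difference of two functions
monotone on `x ≥ 0`. If the positive part at a lower bound for `δ` exceeds the negative part at an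
upper bound, the value is positive; by continuity this happens for some `n` whenever the value is
positive. The numerators suffice, as both denominators are `2 ^ n` to the length of the list. -/
theorem exists_posCheck_iff {δ : ℝ} (hδ : 0 < δ) {a : ℕ → ℤ}
    (ha : ∀ n : ℕ, |δ - (a n : ℝ) / 2 ^ n| ≤ 1 / 2 ^ n) (p : List ℤ) :
    (∃ n, posCheck a n p = true) ↔ 0 < aeval δ (listPoly p) := by
  have hcheck : ∀ n, posCheck a n p = true ↔
      natEval (fun z => (-z).toNat) (((a n).toNat + 1 : ℕ) / (2 ^ n : ℕ)) p <
        natEval Int.toNat (((a n).toNat - 1 : ℕ) / (2 ^ n : ℕ)) p := by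
    intro n
    rw [posCheck, decide_eq_true_iff, ← Nat.cast_lt (α := ℝ), fracEval_fst _ _ _ (by positivity),
      fracEval_fst _ _ _ (by positivity)]
    exact mul_lt_mul_iff_of_pos_right (by positivity)
  have hpow : ∀ n : ℕ, (0 : ℝ) < 2 ^ n := fun n => by positivity
  have hb : ∀ n : ℕ, (((a n).toNat - 1 : ℕ) : ℝ) ≤ δ * 2 ^ n ∧
      δ * 2 ^ n - 2 ≤ (((a n).toNat - 1 : ℕ) : ℝ) ∧
      δ * 2 ^ n ≤ (((a n).toNat + 1 : ℕ) : ℝ) ∧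
      (((a n).toNat + 1 : ℕ) : ℝ) ≤ δ * 2 ^ n + 2 := by
    intro n
    have h := abs_le.1 (ha n)
    have h1 : (a n : ℝ) ≤ δ * 2 ^ n + 1 := by
      have := h.1
      have h2 : (a n : ℝ) / 2 ^ n ≤ δ + 1 / 2 ^ n := by linarith
      rw [div_le_iff₀ (hpow n), add_mul, div_mul_cancel₀ _ (hpow n).ne'] at h2
      exact h2
    have h2 : δ * 2 ^ n - 1 ≤ (a n : ℝ) := by
      have h2 : δ - 1 / 2 ^ n ≤ (a n : ℝ) / 2 ^ n := by linarith [h.2]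
      rw [le_div_iff₀ (hpow n), sub_mul, div_mul_cancel₀ _ (hpow n).ne'] at h2
      exact h2
    have h3 : 0 < δ * 2 ^ n := mul_pos hδ (hpow n)
    -- Since `a n ≥ δ * 2 ^ n - 1 > -1`, passing to natural numbers loses nothing.
    have h4 : 0 ≤ a n := by
      have : (-1 : ℝ) < a n := by linarith
      have : -1 < a n := by exact_mod_cast this
      omega
    obtain ⟨k, hk⟩ := Int.eq_ofNat_of_zero_le h4
    rw [hk] at h1 h2 ⊢
    simp only [Int.cast_natCast] at h1 h2
    rcases k with _ | k
    · simp at h1 h2 ⊢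
      refine ⟨hδ.le, ?_, ?_, ?_⟩ <;> linarith
    · push_cast at h1 h2
      simp
      refine ⟨?_, ?_, ?_, ?_⟩ <;> linarith
  have hlo : ∀ n : ℕ, (((a n).toNat - 1 : ℕ) : ℝ) / (2 ^ n : ℕ) ≤ δ := fun n => by
    push_cast
    rw [div_le_iff₀ (hpow n)]
    exact (hb n).1
  have hhi : ∀ n : ℕ, δ ≤ (((a n).toNat + 1 : ℕ) : ℝ) / (2 ^ n : ℕ) := fun n => by
    rw [Nat.cast_pow, Nat.cast_ofNat, le_div_iff₀ (hpow n)]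
    exact (hb n).2.2.1
  have hlim : Tendsto (fun n : ℕ => (2 : ℝ) / 2 ^ n) atTop (𝓝 0) :=
    tendsto_const_nhds.div_atTop (tendsto_pow_atTop_atTop_of_one_lt one_lt_two)
  constructor
  · rintro ⟨n, hn⟩
    rw [hcheck] at hn
    rw [aeval_listPoly_eq, sub_pos]
    exact (natEval_mono _ hδ.le (hhi n) p).trans_lt
      (hn.trans_le (natEval_mono _ (by positivity) (hlo n) p))
  · intro h
    rw [aeval_listPoly_eq, sub_pos] at h
    have h1 : Tendsto (fun n : ℕ => (((a n).toNat - 1 : ℕ) : ℝ) / (2 ^ n : ℕ)) atTop (𝓝 δ) := by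
      refine tendsto_of_tendsto_of_tendsto_of_le_of_le (g := fun n : ℕ => δ - 2 / 2 ^ n)
        (by simpa using tendsto_const_nhds.sub hlim) tendsto_const_nhds (fun n => ?_) hlo
      dsimp only
      rw [Nat.cast_pow, Nat.cast_ofNat, le_div_iff₀ (hpow n), sub_mul,
        div_mul_cancel₀ _ (hpow n).ne']
      exact (hb n).2.1
    have h2 : Tendsto (fun n : ℕ => (((a n).toNat + 1 : ℕ) : ℝ) / (2 ^ n : ℕ)) atTop (𝓝 δ) := by
      refine tendsto_of_tendsto_of_tendsto_of_le_of_le (h := fun n : ℕ => δ + 2 / 2 ^ n)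
        tendsto_const_nhds (by simpa using tendsto_const_nhds.add hlim) hhi (fun n => ?_)
      dsimp only
      rw [Nat.cast_pow, Nat.cast_ofNat, div_le_iff₀ (hpow n), add_mul,
        div_mul_cancel₀ _ (hpow n).ne']
      exact (hb n).2.2.2
    have h3 := ((continuous_natEval (fun z => (-z).toNat) p).tendsto δ).comp h2
    have h4 := ((continuous_natEval Int.toNat p).tendsto δ).comp h1
    obtain ⟨n, hn⟩ := (h3.eventually_lt h4 h).exists
    exact ⟨n, (hcheck n).2 hn⟩

theorem primrec_fracEval {f : ℤ → ℕ} (hf : Primrec f) :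
    Primrec fun y : (ℕ × ℕ) × List ℤ => fracEval f y.1.1 y.1.2 y.2 := by
  refine Primrec.list_foldr (α := (ℕ × ℕ) × List ℤ)
    (h := fun y s => (f s.1 * (s.2.2 * y.1.2) + y.1.1 * s.2.1, s.2.2 * y.1.2)) .snd
    (.const (0, 1)) ?_
  have h1 : Primrec fun z : ((ℕ × ℕ) × List ℤ) × ℤ × ℕ × ℕ => z.2.2.2 * z.1.1.2 :=
    Primrec.nat_mul.comp (Primrec.snd.comp (Primrec.snd.comp .snd))
      (Primrec.snd.comp (Primrec.fst.comp .fst))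
  exact Primrec.pair (Primrec.nat_add.comp
    (Primrec.nat_mul.comp (hf.comp (Primrec.fst.comp .snd)) h1)
    (Primrec.nat_mul.comp (Primrec.fst.comp (Primrec.fst.comp .fst))
      (Primrec.fst.comp (Primrec.snd.comp .snd)))) h1

theorem primrec_two_pow : Primrec fun n : ℕ => 2 ^ n := by
  refine (Primrec.nat_rec₁ 1 (f := fun _ k => 2 * k)
    (Primrec.nat_mul.comp (.const 2) .snd)).of_eq fun n => ?_
  induction n with
  | zero => rfl
  | succ n ih => rw [pow_succ', ← ih]

theorem computable_posCheck {a : ℕ → ℤ} (ha : Computable a) : Computable₂ (posCheck a) := by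
  have h : Computable fun y : ℕ × List ℤ => (a y.1).toNat :=
    primrec_toNat.to_comp.comp (ha.comp .fst)
  have h2 : Computable fun y : ℕ × List ℤ => 2 ^ y.1 := primrec_two_pow.to_comp.comp .fst
  have h3 : Computable fun y : ℕ × List ℤ => (((a y.1).toNat + 1, 2 ^ y.1), y.2) :=
    ((Primrec.succ.to_comp.comp h).pair h2).pair .snd
  have h4 : Computable fun y : ℕ × List ℤ => (((a y.1).toNat - 1, 2 ^ y.1), y.2) :=
    ((Primrec.pred.to_comp.comp h).pair h2).pair .snd
  have h5 := Computable.fst.comp ((primrec_fracEval primrec_neg_toNat).to_comp.comp h3)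
  have h6 := Computable.fst.comp ((primrec_fracEval primrec_toNat).to_comp.comp h4)
  have h7 := (PrimrecRel.decide Primrec.nat_lt).to_comp.comp h5 h6
  dsimp only at h7
  exact h7

theorem rePred_of_exists {α : Type*} [Primcodable α] {c : α → ℕ → Bool} (hc : Computable₂ c) :
    REPred fun a => ∃ n, c a n = true := by
  refine (Partrec.dom_re (Partrec.rfind hc.partrec₂)).of_eq fun a => ?_
  simp

/-- The sign of an integer polynomial at a computable real number is decidable. -/
theorem exists_computable_pos {δ : ℝ} (hδ : 0 < δ) (hc : IsComputableReal δ) :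
    ∃ pos : List ℤ → Bool, Computable pos ∧ ∀ p, pos p = true ↔ 0 < aeval δ (listPoly p) := by
  obtain ⟨a, ha, haδ⟩ := hc
  -- Only the existence of `q` is needed: it is a constant of the decision procedure.
  obtain ⟨q, hq⟩ := exists_aeval_eq_zero_iff δ
  obtain ⟨q, rfl⟩ := listPoly_surjective q
  have hpos : REPred fun p : List ℤ => 0 < aeval δ (listPoly p) :=
    (rePred_of_exists (c := fun p n => posCheck a n p)
      ((computable_posCheck ha).comp .snd .fst)).of_eq fun p => exists_posCheck_iff hδ haδ p
  -- The number `n` codes a possible certificate `(c, u)` of the identity `c * p = u * q`.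
  let zeroCheck : List ℤ → ℕ → Bool := fun p n =>
    Option.casesOn (Encodable.decode (α := ℤ × List ℤ) n) false fun w =>
      !decide (w.1 = 0) && listIsZero (listAdd (listSmul w.1 p) (listSmul (-1) (listMul w.2 q)))
  have hzero : ∀ p, (∃ n, zeroCheck p n = true) ↔ aeval δ (listPoly p) = 0 := by
    intro p
    have e : ∀ w : ℤ × List ℤ, (!decide (w.1 = 0) && listIsZero (listAdd (listSmul w.1 p)
        (listSmul (-1) (listMul w.2 q)))) = true ↔
        w.1 ≠ 0 ∧ C w.1 * listPoly p = listPoly w.2 * listPoly q := by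
      intro w
      simp [listIsZero_iff, listPoly_listAdd, listPoly_listSmul, listPoly_listMul,
        ← sub_eq_add_neg, sub_eq_zero]
    rw [hq]
    constructor
    · rintro ⟨n, hn⟩
      cases h : Encodable.decode (α := ℤ × List ℤ) n with
      | none => simp only [zeroCheck, h, Bool.false_eq_true] at hn
      | some w =>
        simp only [zeroCheck, h] at hn
        exact ⟨w.1, ((e w).1 hn).1, _, ((e w).1 hn).2⟩
    · rintro ⟨c, hc, u, hu⟩
      obtain ⟨u, rfl⟩ := listPoly_surjective u
      refine ⟨Encodable.encode (c, u), ?_⟩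
      simp only [zeroCheck, Encodable.encodek]
      exact (e (c, u)).2 ⟨hc, hu⟩
  have hzc : Computable₂ zeroCheck := by
    refine Computable.option_casesOn (Computable.decode.comp .snd) (.const false) ?_
    have h1 : Primrec fun z : (List ℤ × ℕ) × ℤ × List ℤ => z.2.1 := Primrec.fst.comp .snd
    have h2 : Primrec fun z : (List ℤ × ℕ) × ℤ × List ℤ => z.2.2 := Primrec.snd.comp .snd
    have h3 : Primrec fun z : (List ℤ × ℕ) × ℤ × List ℤ => z.1.1 := Primrec.fst.comp .fst
    exact (Primrec.and.comp (Primrec.not.comp ((PrimrecRel.decide Primrec.eq).comp h1 (.const 0)))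
      (primrec_listIsZero.comp (primrec_listAdd.comp (primrec_listSmul.comp h1 h3)
        (primrec_listSmul.comp (.const (-1)) (primrec_listMul.comp h2 (.const q)))))).to_comp
  -- The complement is recursively enumerable as well: a value that is not positive is negative,
  -- detected on `-p`, or zero. Post's theorem then gives decidability.
  have hneg : REPred fun p : List ℤ => ¬ 0 < aeval δ (listPoly p) := by
    refine (rePred_of_exists (c := fun p n => posCheck a n (listSmul (-1) p) || zeroCheck p n)
      ?_).of_eq fun p => ?_
    · exact Primrec.or.to_comp.comp ((computable_posCheck ha).comp .snd
        (primrec_listSmul.to_comp.comp (.const (-1)) .fst)) hzc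
    · simp only [Bool.or_eq_true, exists_or, hzero, exists_posCheck_iff hδ haδ, listPoly_listSmul]
      simp [le_iff_lt_or_eq]
  obtain ⟨pos, h1, h2⟩ := ComputablePred.computable_iff.1
    (ComputablePred.computable_iff_re_compl_re'.2 ⟨hpos, hneg⟩)
  exact ⟨pos, h1, fun p => (iff_of_eq (congrFun h2 p)).symm⟩

end Sign

/-! ### Exact simulation of coded networks is computable -/

section Combinators

variable {α σ : Type*} [Primcodable α] [Primcodable σ]

theorem Computable.map_range {n : α → ℕ} {f : α → ℕ → σ} (hn : Computable n)
    (hf : Computable₂ f) : Computable fun a => (List.range (n a)).map (f a) := by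
  refine (Computable.nat_rec (h := fun a y => y.2 ++ [f a y.1]) hn (.const [])
    (Computable.list_concat.comp (Computable.snd.comp .snd)
      (hf.comp .fst (Computable.fst.comp .snd)))).of_eq fun a => ?_
  induction n a with
  | zero => rfl
  | succ k ih => rw [List.range_succ, List.map_append, ← ih]; rfl

theorem Computable.sum_range {n : α → ℕ} {f : α → ℕ → ℕ} (hn : Computable n)
    (hf : Computable₂ f) : Computable fun a => ∑ i ∈ Finset.range (n a), f a i := by
  refine (Computable.nat_rec (h := fun a y => y.2 + f a y.1) hn (.const 0)
    (Primrec.nat_add.to_comp.comp (Computable.snd.comp .snd)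
      (hf.comp .fst (Computable.fst.comp .snd)))).of_eq fun a => ?_
  induction n a with
  | zero => rfl
  | succ k ih => rw [Finset.sum_range_succ, ← ih]

end Combinators

/-- Codes of looped networks of constant width together with a number of iterations: the width
minus `3`, the number of hidden layers, the list of parameters, and the number of iterations. -/
abbrev NetCode (K : ℕ) := ℕ × ℕ × List (Fin (2 * K + 1)) × ℕ

namespace NetCode

variable {K : ℕ}

/-- The parameters: `j = 0` stands for the bias of the neuron `i` of the layer `l`. -/
def entry (c : NetCode K) (l i j : ℕ) : ℤ :=
  ((c.2.2.1.getD (Nat.pair l (Nat.pair i j)) ⟨K, by omega⟩ : Fin (2 * K + 1)) : ℕ) - (K : ℤ)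

/-- The layers of a coded network. -/
noncomputable def layer (δ : ℝ) (c : NetCode K) (l : ℕ) : AffineLayer (c.1 + 3) (c.1 + 3) where
  weight i j := δ * c.entry l i (j + 1)
  bias i := δ * c.entry l i 0

/-- The coded network. -/
noncomputable def net (δ : ℝ) (c : NetCode K) : LoopedNet :=
  ⟨c.1 + 3, by omega, FeedforwardNet.ofFn c.2.1 (c.layer δ)⟩

/-- The value of a neuron, as a polynomial in `δ`. -/
def neuronVal (c : NetCode K) (l i : ℕ) (xs : List (List ℤ)) : List ℤ :=
  0 :: Nat.rec [c.entry l i 0]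
    (fun j s => listAdd s (listSmul (c.entry l i (j + 1)) (xs.getD j []))) (c.1 + 3)

variable (pos : List ℤ → Bool)

/-- The values of the neurons of a hidden layer, as polynomials in `δ`. -/
def hiddenVals (c : NetCode K) (l : ℕ) (xs : List (List ℤ)) : List (List ℤ) :=
  (List.range (c.1 + 3)).map fun i =>
    bif pos (c.neuronVal l i xs) then c.neuronVal l i xs else []

/-- The output of the block, as polynomials in `δ`. -/
def blockVals (c : NetCode K) (xs : List (List ℤ)) : List (List ℤ) :=
  (List.range (c.1 + 3)).map fun i =>
    c.neuronVal c.2.1 i (Nat.rec xs (fun l h => c.hiddenVals pos l h) c.2.1)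

/-- The states of the network, as polynomials in `δ`. -/
def stateVals (c : NetCode K) (t : ℕ) : List (List ℤ) :=
  Nat.rec [] (fun _ xs => c.blockVals pos xs) t

/-- The sign of a coordinate of the state. -/
def chan (c : NetCode K) (t i : ℕ) : Bool := pos ((c.stateVals pos t).getD i [])

/-- The bits appended to the output during the first iterations. -/
def emittedVals (c : NetCode K) (t : ℕ) : List Bool :=
  Nat.rec [] (fun t s => bif c.chan pos (t + 1) 1 then s ++ [c.chan pos (t + 1) 2] else s) t

/-- The network does not halt during the first iterations. -/
def runs (c : NetCode K) (t : ℕ) : Bool :=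
  Nat.rec true (fun t b => b && !c.chan pos (t + 1) 0) t

/-- The number of non-zero parameters. -/
def count (c : NetCode K) : ℕ :=
  ∑ l ∈ Finset.range (c.2.1 + 1), ∑ i ∈ Finset.range (c.1 + 3), ∑ j ∈ Finset.range (c.1 + 4),
    bif decide (c.entry l i j = 0) then 0 else 1

/-- The number of non-zero parameters if the network outputs the string `s` in the given time. -/
def score (K : ℕ) (s : List Bool) (w : ℕ) : Option ℕ :=
  Option.casesOn (Encodable.decode (α := NetCode K) w) none fun c =>
    bif c.chan pos (c.2.2.2 + 1) 0 && (c.runs pos c.2.2.2 && decide (c.emittedVals pos c.2.2.2 = s))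
    then some c.count else none

section Computability

variable {pos}

variable {α : Type*} [Primcodable α] {c : α → NetCode K} {l i j t : α → ℕ}
  {xs : α → List (List ℤ)}

theorem computable_entry (hc : Computable c) (hl : Computable l) (hi : Computable i)
    (hj : Computable j) : Computable fun a => (c a).entry (l a) (i a) (j a) := by
  have h1 : Computable fun a => (c a).2.2.1 :=
    Computable.fst.comp (Computable.snd.comp (Computable.snd.comp hc))
  have h2 : Computable fun a => Nat.pair (l a) (Nat.pair (i a) (j a)) :=
    Primrec₂.natPair.to_comp.comp hl (Primrec₂.natPair.to_comp.comp hi hj)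
  have h3 := (Primrec.list_getD (⟨K, by omega⟩ : Fin (2 * K + 1))).to_comp.comp h1 h2
  exact (Primrec.dom_finite fun w : Fin (2 * K + 1) => ((w : ℕ) : ℤ) - (K : ℤ)).to_comp.comp h3

theorem computable_listAdd {p q : α → List ℤ} (hp : Computable p) (hq : Computable q) :
    Computable fun a => listAdd (p a) (q a) := primrec_listAdd.to_comp.comp hp hq

theorem computable_listSmul {p : α → ℤ} {q : α → List ℤ} (hp : Computable p) (hq : Computable q) :
    Computable fun a => listSmul (p a) (q a) := primrec_listSmul.to_comp.comp hp hq

theorem computable_getD (hxs : Computable xs) (hi : Computable i) :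
    Computable fun a => (xs a).getD (i a) [] := (Primrec.list_getD []).to_comp.comp hxs hi

theorem computable_add_const {n : α → ℕ} (hn : Computable n) (k : ℕ) :
    Computable fun a => n a + k := Primrec.nat_add.to_comp.comp hn (.const k)

theorem computable_neuronVal (hc : Computable c) (hl : Computable l) (hi : Computable i)
    (hxs : Computable xs) : Computable fun a => (c a).neuronVal (l a) (i a) (xs a) := by
  have h0 : Computable fun a => (c a).1 + 3 := computable_add_const (Computable.fst.comp hc) 3
  have h1 := Computable.list_cons.comp (computable_entry hc hl hi (.const 0)) (.const [])
  have ha : Computable fun z : α × ℕ × List ℤ => z.1 := .fst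
  have hj : Computable fun z : α × ℕ × List ℤ => z.2.1 := Computable.fst.comp .snd
  have hs : Computable fun z : α × ℕ × List ℤ => z.2.2 := Computable.snd.comp .snd
  have h2 := computable_listAdd hs (computable_listSmul (computable_entry (hc.comp ha) (hl.comp ha)
    (hi.comp ha) (Computable.succ.comp hj)) (computable_getD (hxs.comp ha) hj))
  exact Computable.list_cons.comp (.const 0) (Computable.nat_rec h0 h1 h2.to₂)

theorem computable_hiddenVals (hpos : Computable pos) (hc : Computable c) (hl : Computable l)
    (hxs : Computable xs) : Computable fun a => (c a).hiddenVals pos (l a) (xs a) := by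
  have h0 : Computable fun a => (c a).1 + 3 := computable_add_const (Computable.fst.comp hc) 3
  have ha : Computable fun z : α × ℕ => z.1 := .fst
  have h1 := computable_neuronVal (hc.comp ha) (hl.comp ha) .snd (hxs.comp ha)
  have h2 := Computable.cond (hpos.comp h1) h1 (.const [])
  exact Computable.map_range h0 h2.to₂

theorem computable_blockVals (hpos : Computable pos) (hc : Computable c) (hxs : Computable xs) :
    Computable fun a => (c a).blockVals pos (xs a) := by
  have h0 : Computable fun a => (c a).1 + 3 := computable_add_const (Computable.fst.comp hc) 3
  have hn : Computable fun a => (c a).2.1 := Computable.fst.comp (Computable.snd.comp hc)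
  have ha : Computable fun z : α × ℕ × List (List ℤ) => z.1 := .fst
  have h1 := computable_hiddenVals hpos (hc.comp ha) (Computable.fst.comp .snd)
    (Computable.snd.comp .snd)
  have h2 := Computable.nat_rec hn hxs h1.to₂
  have hb : Computable fun z : α × ℕ => z.1 := .fst
  have h3 := computable_neuronVal (hc.comp hb) (hn.comp hb) .snd (h2.comp hb)
  exact Computable.map_range h0 h3.to₂

theorem computable_chan (hpos : Computable pos) (hc : Computable c) (ht : Computable t)
    (hi : Computable i) : Computable fun a => (c a).chan pos (t a) (i a) := by
  have ha : Computable fun z : α × ℕ × List (List ℤ) => z.1 := .fst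
  have h1 := computable_blockVals hpos (hc.comp ha) (Computable.snd.comp .snd)
  have h2 := Computable.nat_rec ht (.const []) h1.to₂
  exact hpos.comp (computable_getD h2 hi)

theorem computable_emittedVals (hpos : Computable pos) (hc : Computable c) (ht : Computable t) :
    Computable fun a => (c a).emittedVals pos (t a) := by
  have ha : Computable fun z : α × ℕ × List Bool => z.1 := .fst
  have hs : Computable fun z : α × ℕ × List Bool => z.2.1 + 1 :=
    computable_add_const (Computable.fst.comp .snd) 1
  have hl : Computable fun z : α × ℕ × List Bool => z.2.2 := Computable.snd.comp .snd
  have h1 := computable_chan hpos (hc.comp ha) hs (.const 1)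
  have h2 := computable_chan hpos (hc.comp ha) hs (.const 2)
  have h3 := Computable.cond h1 (Computable.list_concat.comp hl h2) hl
  exact Computable.nat_rec ht (.const []) h3.to₂

theorem computable_runs (hpos : Computable pos) (hc : Computable c) (ht : Computable t) :
    Computable fun a => (c a).runs pos (t a) := by
  have ha : Computable fun z : α × ℕ × Bool => z.1 := .fst
  have hs : Computable fun z : α × ℕ × Bool => z.2.1 + 1 :=
    computable_add_const (Computable.fst.comp .snd) 1
  have hl : Computable fun z : α × ℕ × Bool => z.2.2 := Computable.snd.comp .snd
  have h1 := computable_chan hpos (hc.comp ha) hs (.const 0)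
  have h2 := Primrec.and.to_comp.comp hl (Primrec.not.to_comp.comp h1)
  exact Computable.nat_rec ht (.const true) h2.to₂

theorem computable_count (hc : Computable c) : Computable fun a => (c a).count := by
  have h1 : Computable fun a => (c a).1 := Computable.fst.comp hc
  have h3 : Computable fun a => (c a).2.1 := Computable.fst.comp (Computable.snd.comp hc)
  have ha : Computable fun z : ((α × ℕ) × ℕ) × ℕ => z.1.1.1 :=
    Computable.fst.comp (Computable.fst.comp .fst)
  have hl : Computable fun z : ((α × ℕ) × ℕ) × ℕ => z.1.1.2 :=
    Computable.snd.comp (Computable.fst.comp .fst)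
  have hi : Computable fun z : ((α × ℕ) × ℕ) × ℕ => z.1.2 := Computable.snd.comp .fst
  have he := computable_entry (hc.comp ha) hl hi .snd
  have h4 := Computable.cond ((PrimrecRel.decide Primrec.eq).to_comp.comp he (.const 0))
    (.const 0) (.const 1)
  have h5 := Computable.sum_range (computable_add_const
    (h1.comp (Computable.fst.comp (Computable.fst (α := α × ℕ) (β := ℕ)))) 4) h4.to₂
  have h6 := Computable.sum_range (computable_add_const
    (h1.comp (Computable.fst (α := α) (β := ℕ))) 3) h5.to₂
  exact Computable.sum_range (computable_add_const h3 1) h6.to₂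

theorem computable_score (hpos : Computable pos) : Computable₂ (score pos K) := by
  have hc : Computable fun z : (List Bool × ℕ) × NetCode K => z.2 := .snd
  have ht : Computable fun z : (List Bool × ℕ) × NetCode K => z.2.2.2.2 :=
    Computable.snd.comp (Computable.snd.comp (Computable.snd.comp .snd))
  have hs : Computable fun z : (List Bool × ℕ) × NetCode K => z.1.1 := Computable.fst.comp .fst
  have h1 := computable_chan hpos hc (computable_add_const ht 1) (.const 0)
  have h2 := computable_runs hpos hc ht
  have h3 := (PrimrecRel.decide Primrec.eq).to_comp.comp (computable_emittedVals hpos hc ht) hs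
  have h4 := Computable.cond (Primrec.and.to_comp.comp h1 (Primrec.and.to_comp.comp h2 h3))
    (Computable.option_some.comp (computable_count hc)) (.const none)
  exact Computable.option_casesOn (Computable.decode.comp .snd) (.const none) h4.to₂

end Computability

end NetCode

/-! ### Correctness of the simulation and completeness of the codes -/

namespace NetCode

open Polynomial

variable {K : ℕ} {δ : ℝ} {pos : List ℤ → Bool}

/-- Every parameter is an integer times `δ`, so an affine form is `δ` times an integer combination;
the leading `0` in the coefficient list is this multiplication by `δ`. -/
theorem aeval_neuronVal (c : NetCode K) (l : ℕ) (i : Fin (c.1 + 3)) {xs : List (List ℤ)}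
    {x : Fin (c.1 + 3) → ℝ} (hx : ∀ j : Fin (c.1 + 3), aeval δ (listPoly (xs.getD j [])) = x j) :
    aeval δ (listPoly (c.neuronVal l i xs)) = (c.layer δ l).eval x i := by
  have key : ∀ k : ℕ, aeval δ (listPoly (Nat.rec [c.entry l i 0]
      (fun j s => listAdd s (listSmul (c.entry l i (j + 1)) (xs.getD j []))) k)) =
      c.entry l i 0 +
        ∑ j ∈ Finset.range k, c.entry l i (j + 1) * aeval δ (listPoly (xs.getD j [])) := by
    intro k
    induction k with
    | zero => simp [listPoly]
    | succ k ih =>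
      dsimp only
      rw [listPoly_listAdd, map_add, ih, Finset.sum_range_succ, listPoly_listSmul, map_mul]
      simp [add_assoc]
  have e : (c.layer δ l).eval x i =
    ∑ j : Fin (c.1 + 3), δ * c.entry l i (j + 1) * x j + δ * c.entry l i 0 := rfl
  have e0 : ∀ q, aeval δ (listPoly (0 :: q)) = δ * aeval δ (listPoly q) := fun q => by
    simp [listPoly_cons]
  refine (e0 _).trans ((congrArg (δ * ·) (key (c.1 + 3))).trans ?_)
  rw [e, Finset.sum_range]
  simp only [hx, mul_add, Finset.mul_sum, mul_assoc]
  rw [add_comm]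

/-- ReLU is carried out without rounding: the sign test at `δ` decides between keeping the
polynomial and replacing it by the zero polynomial `[]`. -/
theorem aeval_hiddenVals (hpos : ∀ p, pos p = true ↔ 0 < aeval δ (listPoly p))
    (c : NetCode K) (x : Fin (c.1 + 3) → ℝ) {xs : List (List ℤ)}
    (hx : ∀ j : Fin (c.1 + 3), aeval δ (listPoly (xs.getD j [])) = x j) (n : ℕ) :
    ∀ j : Fin (c.1 + 3), aeval δ (listPoly
      ((Nat.rec xs (fun l h => c.hiddenVals pos l h) n : List (List ℤ)).getD j [])) =
        FeedforwardNet.hiddenState (c.layer δ) x n j := by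
  induction n with
  | zero => exact hx
  | succ n ih =>
    intro j
    have e := aeval_neuronVal c n j ih
    dsimp only
    simp only [FeedforwardNet.hiddenState]
    rw [← e, hiddenVals, List.getD_eq_getElem _ _ (by simp)]
    simp only [List.getElem_map, List.getElem_range]
    cases h : pos (c.neuronVal n j (Nat.rec xs (fun l h => c.hiddenVals pos l h) n))
    · rw [cond_false, max_eq_right]
      · simp [listPoly]
      · rw [← not_lt, ← hpos, h]
        simp
    · rw [cond_true, max_eq_left ((hpos _).1 h).le]

theorem aeval_stateVals (hpos : ∀ p, pos p = true ↔ 0 < aeval δ (listPoly p))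
    (c : NetCode K) (t : ℕ) : ∀ j : Fin (c.1 + 3),
    aeval δ (listPoly ((c.stateVals pos t).getD j [])) = (c.net δ).state t j := by
  induction t with
  | zero =>
    intro j
    have : (c.net δ).state 0 j = 0 := rfl
    rw [this]
    simp [stateVals, listPoly]
  | succ t ih =>
    intro j
    have e1 : (c.net δ).state (t + 1) = (c.net δ).block.eval ((c.net δ).state t) :=
      Function.iterate_succ_apply' _ _ _
    have e2 : (c.net δ).block.eval ((c.net δ).state t) = _ :=
      FeedforwardNet.eval_ofFn c.2.1 (c.layer δ) _
    rw [e1, e2, ← aeval_neuronVal c c.2.1 j (aeval_hiddenVals hpos c _ ih c.2.1)]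
    have e3 : c.stateVals pos (t + 1) = c.blockVals pos (c.stateVals pos t) := rfl
    rw [e3, blockVals, List.getD_eq_getElem _ _ (by simp)]
    simp only [List.getElem_map, List.getElem_range]

theorem chan_eq_true_iff (hpos : ∀ p, pos p = true ↔ 0 < aeval δ (listPoly p))
    (c : NetCode K) (t : ℕ) {i : ℕ} (hi : i < c.1 + 3) :
    c.chan pos t i = true ↔ 0 < (c.net δ).state t ⟨i, hi⟩ := by
  rw [chan, hpos]
  exact iff_of_eq (congrArg (0 < ·) (aeval_stateVals hpos c t ⟨i, hi⟩))

theorem emittedVals_eq (hpos : ∀ p, pos p = true ↔ 0 < aeval δ (listPoly p))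
    (c : NetCode K) (t : ℕ) : c.emittedVals pos t = (c.net δ).emitted t := by
  induction t with
  | zero => rfl
  | succ t ih =>
    have e : c.emittedVals pos (t + 1) = bif c.chan pos (t + 1) 1 then
      c.emittedVals pos t ++ [c.chan pos (t + 1) 2] else c.emittedVals pos t := rfl
    have h1 : c.chan pos (t + 1) 1 = true ↔ 0 < (c.net δ).emit (t + 1) :=
      chan_eq_true_iff hpos c (t + 1) (by omega)
    have h2 : c.chan pos (t + 1) 2 = decide (0 < (c.net δ).bit (t + 1)) :=
      Bool.eq_iff_iff.2 ((chan_eq_true_iff hpos c (t + 1) (by omega)).trans decide_eq_true_iff.symm)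
    rw [e, ih, h2, LoopedNet.emitted, Bool.cond_eq_ite]
    simp only [h1]

theorem runs_eq_true_iff (hpos : ∀ p, pos p = true ↔ 0 < aeval δ (listPoly p))
    (c : NetCode K) (t : ℕ) :
    c.runs pos t = true ↔ ∀ u, 1 ≤ u → u ≤ t → ¬ 0 < (c.net δ).halt u := by
  induction t with
  | zero => exact iff_of_true rfl fun u h1 h2 => by omega
  | succ t ih =>
    have e : c.runs pos (t + 1) = (c.runs pos t && !c.chan pos (t + 1) 0) := rfl
    have h1 : c.chan pos (t + 1) 0 = true ↔ 0 < (c.net δ).halt (t + 1) :=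
      chan_eq_true_iff hpos c (t + 1) (by omega)
    rw [e, Bool.and_eq_true, ih, Bool.not_eq_true', ← Bool.not_eq_true, h1]
    refine ⟨fun h u hu hut => ?_, fun h =>
      ⟨fun u hu hut => h u hu (by omega), h _ (by omega) le_rfl⟩⟩
    rcases hut.lt_or_eq with hlt | rfl
    exacts [h.1 u hu (by omega), h.2]

theorem score_eq_some_iff (hpos : ∀ p, pos p = true ↔ 0 < aeval δ (listPoly p))
    {s : List Bool} {w k : ℕ} : score pos K s w = some k ↔
    ∃ c : NetCode K, Encodable.decode w = some c ∧ c.count = k ∧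
      0 < (c.net δ).halt (c.2.2.2 + 1) ∧
        (∀ t, 1 ≤ t → t ≤ c.2.2.2 → ¬ 0 < (c.net δ).halt t) ∧ (c.net δ).emitted c.2.2.2 = s := by
  rw [score]
  cases Encodable.decode (α := NetCode K) w with
  | none => simp
  | some c =>
    have h1 : c.chan pos (c.2.2.2 + 1) 0 = true ↔ 0 < (c.net δ).halt (c.2.2.2 + 1) :=
      chan_eq_true_iff hpos c _ (by omega)
    simp only [Option.some.injEq, exists_eq_left', Bool.cond_eq_ite, Option.ite_none_right_eq_some,
      Bool.and_eq_true, decide_eq_true_iff, h1, runs_eq_true_iff hpos, emittedVals_eq hpos]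
    tauto

theorem count_eq (hδ : δ ≠ 0) (c : NetCode K) : c.count = (c.net δ).block.numNonzero := by
  have e : (c.net δ).block.numNonzero = _ := FeedforwardNet.numNonzero_ofFn c.2.1 (c.layer δ)
  rw [e, count]
  refine Finset.sum_congr rfl fun l _ => ?_
  rw [AffineLayer.numNonzero, Finset.card_filter, Finset.card_filter, Fintype.sum_prod_type,
    ← Finset.sum_add_distrib, Finset.sum_range]
  refine Finset.sum_congr rfl fun i _ => ?_
  -- The term `j = 0` that is split off is the bias.
  rw [Finset.sum_range_succ', Finset.sum_range]
  simp [layer, hδ, Bool.cond_eq_ite]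

/-- No validity test for codes is needed: a parameter missing from the list defaults to the index
`K`, that is, to the value `0`. -/
theorem isFixedPrecision_net {M : ℝ} (hδ : 0 < δ) (hM : δ ≤ M) (c : NetCode ⌊M / δ⌋₊) :
    (c.net δ).block.IsFixedPrecision δ M := by
  refine FeedforwardNet.isFixedPrecision_ofFn.2 fun l _ => ⟨fun i j => ?_, fun i => ?_⟩ <;>
    exact (mem_fixedPrecisionValues_iff hδ hM).2 ⟨_, rfl⟩

/-- Layers of bounded precision are the layers of some coded network. -/
theorem exists_layer_eq {M : ℝ} (hδ : 0 < δ) (hM : δ ≤ M) {m n : ℕ}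
    (A : ℕ → AffineLayer (m + 3) (m + 3)) (hA : ∀ l ≤ n, (A l).IsFixedPrecision δ M) (τ : ℕ) :
    ∃ flat : List (Fin (2 * ⌊M / δ⌋₊ + 1)), ∀ l ≤ n, layer δ (m, n, flat, τ) l = A l := by
  choose g hg using fun v : fixedPrecisionValues δ M => (mem_fixedPrecisionValues_iff hδ hM).1 v.2
  classical
  let v : ℕ → ℕ → ℕ → ℝ := fun l i j => if hi : i < m + 3 then
    if hj : j - 1 < m + 3 then
      if j = 0 then (A l).bias ⟨i, hi⟩ else (A l).weight ⟨i, hi⟩ ⟨j - 1, hj⟩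
      else 0
    else 0
  let f : ℝ → Fin (2 * ⌊M / δ⌋₊ + 1) := fun x =>
    if hx : x ∈ fixedPrecisionValues δ M then g ⟨x, hx⟩ else 0
  have hf : ∀ x ∈ fixedPrecisionValues δ M,
      δ * (((f x : ℕ) : ℤ) - (⌊M / δ⌋₊ : ℤ) : ℤ) = x := by
    intro x hx
    simp only [f, dif_pos hx]
    exact (hg ⟨x, hx⟩).symm
  let u : ℕ → Fin (2 * ⌊M / δ⌋₊ + 1) := fun q =>
    f (v q.unpair.1 q.unpair.2.unpair.1 q.unpair.2.unpair.2)
  -- The pairing function is strictly increasing in both arguments, so this length exceeds every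
  -- index in use.
  let flat := (List.range (Nat.pair (n + 1) (Nat.pair (m + 4) (m + 5)))).map u
  have hent : ∀ l ≤ n, ∀ i < m + 3, ∀ j < m + 4,
      entry (m, n, flat, τ) l i j = ((f (v l i j) : ℕ) : ℤ) - (⌊M / δ⌋₊ : ℤ) := by
    intro l hl i hi j hj
    have hlt : Nat.pair l (Nat.pair i j) < Nat.pair (n + 1) (Nat.pair (m + 4) (m + 5)) :=
      (Nat.pair_lt_pair_left _ (by omega)).trans (Nat.pair_lt_pair_right _
        ((Nat.pair_lt_pair_left _ (by omega)).trans (Nat.pair_lt_pair_right _ (by omega))))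
    rw [entry]
    dsimp only [flat]
    rw [List.getD_eq_getElem _ _ (by simpa using hlt)]
    simp [u]
  refine ⟨flat, fun l hl => ?_⟩
  have hw : (layer δ (m, n, flat, τ) l).weight = (A l).weight := by
    ext i j
    have : v l i (j + 1) = (A l).weight i j := by simp [v]
    simp only [layer]
    rw [hent l hl i i.2 (j + 1) (by omega), this, hf _ ((hA l hl).1 i j)]
  have hb : (layer δ (m, n, flat, τ) l).bias = (A l).bias := by
    ext i
    have : v l i 0 = (A l).bias i := by simp [v]
    simp only [layer]
    rw [hent l hl i i.2 0 (by omega), this, hf _ ((hA l hl).2 i)]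
  have eta : ∀ B C : AffineLayer (m + 3) (m + 3), B.weight = C.weight →
      B.bias = C.bias → B = C := by
    rintro ⟨_, _⟩ ⟨_, _⟩ rfl rfl
    rfl
  exact eta _ _ hw hb

variable {M : ℝ}

theorem neuralComplexity_le_of_score (hδ : 0 < δ) (hM : δ ≤ M)
    (hpos : ∀ p, pos p = true ↔ 0 < aeval δ (listPoly p)) (s : List Bool) (w : ℕ) :
    neuralComplexity δ M s ≤ extNat (score pos ⌊M / δ⌋₊ s w) := by
  cases h : score pos ⌊M / δ⌋₊ s w with
  | none => exact le_top
  | some k =>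
    obtain ⟨c, -, rfl, hout⟩ := (score_eq_some_iff hpos).1 h
    exact neuralComplexity_le_iff.2 ⟨c.net δ, isFixedPrecision_net hδ hM c, ⟨_, hout⟩,
      (count_eq hδ.ne' c).ge⟩

/-- The normal form gives a network of width `m + 3` that is no larger and can be coded. Its halting
time is stored in the code, which makes the test of the output a bounded computation. -/
theorem exists_score_le (hδ : 0 < δ) (hM : δ ≤ M)
    (hpos : ∀ p, pos p = true ↔ 0 < aeval δ (listPoly p)) {s : List Bool} {m : ℕ}
    (h : neuralComplexity δ M s ≤ m) : ∃ w, extNat (score pos ⌊M / δ⌋₊ s w) ≤ m := by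
  obtain ⟨N, h1, h2, h3⟩ := neuralComplexity_le_iff.1 h
  obtain ⟨A, hA, hle, hout⟩ := N.exists_ofFn (hδ.le.trans hM) h1 h3
  rw [FeedforwardNet.isFixedPrecision_ofFn] at hA
  obtain ⟨τ, hτ⟩ := hout s h2
  obtain ⟨flat, hflat⟩ := exists_layer_eq hδ hM A hA τ
  let c : NetCode ⌊M / δ⌋₊ := (m, N.block.depth, flat, τ)
  have hc : c.net δ = ⟨m + 3, by omega, FeedforwardNet.ofFn N.block.depth A⟩ := by
    rw [net, FeedforwardNet.ofFn_congr hflat]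
  rw [← hc] at hτ
  have hs : score pos ⌊M / δ⌋₊ s (Encodable.encode c) = some c.count :=
    (score_eq_some_iff hpos).2 ⟨c, Encodable.encodek c, rfl, hτ⟩
  refine ⟨Encodable.encode c, ?_⟩
  rw [hs, count_eq hδ.ne' c, hc]
  exact Nat.cast_le.2 (hle.trans h3)

end NetCode

/-! ### Upper semicomputability and conclusion -/

/-- The infimum of a computable family is upper-semicomputable. -/
theorem isUpperSemicomputable_of_iInf {F : List Bool → ℕ∞} {f : List Bool → ℕ → Option ℕ}
    (hf : Computable₂ f) (hF : ∀ s, F s = ⨅ w, extNat (f s w)) : IsUpperSemicomputable F := by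
  let mn : Option ℕ → Option ℕ → Option ℕ := fun a b =>
    Option.casesOn a b fun m => Option.casesOn b (some m) fun n => some (min m n)
  have hmn : Computable₂ mn := by
    have h1 := Computable.option_some.comp (Primrec.nat_min.to_comp.comp
      (Computable.snd.comp (Computable.fst (α := (Option ℕ × Option ℕ) × ℕ) (β := ℕ))) .snd)
    have h2 := Computable.option_casesOn
      (Computable.snd.comp (Computable.fst (α := Option ℕ × Option ℕ) (β := ℕ)))
      (Computable.option_some.comp .snd) h1.to₂
    exact Computable.option_casesOn .fst .snd h2.to₂
  have hext : ∀ a b, extNat (mn a b) = min (extNat a) (extNat b) := by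
    rintro (_ | m) (_ | n)
    · exact (min_self _).symm
    · exact (min_eq_right le_top).symm
    · exact (min_eq_left le_top).symm
    · exact Nat.mono_cast.map_min
  -- The minimum of the first `k` values, starting from `none`, that is, from `∞`.
  let φ : List Bool → ℕ → Option ℕ := fun s k => Nat.rec none (fun k o => mn o (f s k)) k
  have hsucc : ∀ s k, extNat (φ s (k + 1)) = min (extNat (φ s k)) (extNat (f s k)) := fun s k =>
    hext _ _
  have hanti : ∀ s, Antitone fun k => extNat (φ s k) := fun s =>
    antitone_nat_of_succ_le fun k => (hsucc s k).trans_le (min_le_left _ _)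
  refine ⟨φ, ?_, fun s => ⟨hanti s, ?_⟩⟩
  · have h1 := hmn.comp
      (Computable.snd.comp (Computable.snd (α := List Bool × ℕ) (β := ℕ × Option ℕ)))
      (hf.comp (Computable.fst.comp .fst) (Computable.fst.comp .snd))
    exact Computable.nat_rec .snd (.const none) h1.to₂
  · have hinf : F s = ⨅ k, extNat (φ s k) := by
      rw [hF]
      refine le_antisymm (le_iInf fun k => ?_) (le_iInf fun w => ?_)
      · induction k with
        | zero => exact le_top
        | succ k ih =>
          rw [hsucc]
          exact le_min ih (iInf_le _ k)
      · exact (iInf_le _ (w + 1)).trans ((hsucc s w).trans_le (min_le_right _ _))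
    rw [hinf]
    exact tendsto_atTop_iInf (hanti s)

theorem isUpperSemicomputable_neuralComplexity {δ M : ℝ} (hδ : 0 < δ) (hM : δ ≤ M)
    (hc : IsComputableReal δ) : IsUpperSemicomputable (neuralComplexity δ M) := by
  obtain ⟨pos, h1, h2⟩ := exists_computable_pos hδ hc
  refine isUpperSemicomputable_of_iInf (NetCode.computable_score (K := ⌊M / δ⌋₊) h1) fun s =>
    le_antisymm (le_iInf fun w => NetCode.neuralComplexity_le_of_score hδ hM h2 s w) ?_
  rcases h : neuralComplexity δ M s with _ | m
  · exact le_top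
  · obtain ⟨w, hw⟩ := NetCode.exists_score_le hδ hM h2 h.le
    exact (iInf_le _ w).trans hw

theorem mainTheorem6 (δ M : ℝ) (hδ : 0 < δ) (hM : δ ≤ M) :
    (IsComputableReal δ → IsUpperSemicomputable (neuralComplexity δ M)) ∧
      ¬ IsComputableENat (neuralComplexity δ M) :=
  ⟨isUpperSemicomputable_neuralComplexity hδ hM, not_isComputableENat_neuralComplexity hδ hM⟩
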